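/- Theorem 3.2. Let $M$ be a smooth $n$-manifold with a linear double disk bundle decomposition, that is: there are closed (compact, without boundary) smooth manifolds $L_\pm$ of dimensions $d_\pm$ and smooth Euclidean vector bundles $E_\pm\to L_\pm$ of ranks $k_\pm=n-d_\pm\ge 1$, with closed unit disk bundles $\mathcal P_\pm:\mathcal D_\pm\to L_\pm$ and unit sphere bundles $\partial\mathcal D_\pm$, a diffeomorphism $\phi:\partial\mathcal D_+\to\partial\mathcal D_-$, and smooth embeddings $j_\pm:\mathcal D_\pm\to M$ such that $M=j_+(\mathcal D_+)\cup j_-(\mathcal D_-)$, $j_+(\mathcal D_+)\cap j_-(\mathcal D_-)=j_+(\partial\mathcal D_+)$ and $j_-\circ\phi=j_+$ on $\partial\mathcal D_+$. (Thus $L_\pm$, as zero sections, are submanifolds of $M$ of codimension $n-d_\pm$.) Assume that $n-d_+>1$ and $n-d_->1$. Let $i_\pm:\partial\mathcal D_\pm\hookrightarrow\mathcal D_\pm$ be the inclusions, and let $x\in\partial\mathcal D_+$ be any base point; take the fundamental groups of $\partial\mathcal D_+$, $\mathcal D_+$, $L_+$, $M$, $\partial\mathcal D_-$, $\mathcal D_-$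 at $x$, $i_+(x)$, $\mathcal P_+(x)$, $j_+(x)$, $\phi(x)$, $i_-(\phi(x))$ respectively. Then $$\pi_1(M)\cong\pi_1(L_+)/N,$$ where $N=\mathcal P_{+*}\big(i_{+*}(\operatorname{Ker}(i_{-*}\circ\phi_*))\big)$ is a normal subgroup of $\pi_1(L_+)$, isomorphic to $i_{+*}(\operatorname{Ker}(i_{-*}\circ\phi_*))\subseteq\pi_1(\mathcal D_+)$. If moreover $n-d_->2$, then $\pi_1(M)\cong\pi_1(L_+)$. -/

import Mathlib

open Bundle Manifold
open scoped ContDiff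

namespace DoubleDisk

section DiskBundle

variable {B : Type*} (F : Type*) (E : B → Type*) [∀ b, NormedAddCommGroup (E b)]

/-- The closed unit disk bundle of a vector bundle whose fibres carry norms
(below: the norms of a smooth Euclidean bundle metric). -/
def diskBundle : Set (TotalSpace F E) := {v | ‖v.snd‖ ≤ 1}

/-- The unit sphere bundle, which is the boundary of the closed unit disk bundle. -/
def sphereBundle : Set (TotalSpace F E) := {v | ‖v.snd‖ = 1}

theorem sphereBundle_subset_diskBundle : sphereBundle F E ⊆ diskBundle F E :=
  fun _ hv => le_of_eq hv

variable [TopologicalSpace (TotalSpace F E)]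

/-- The inclusion of the boundary of the disk bundle into the disk bundle. -/
def boundaryIncl : C(sphereBundle F E, diskBundle F E) where
  toFun := Set.inclusion (sphereBundle_subset_diskBundle F E)
  continuous_toFun := continuous_inclusion _

/-- The projection of the disk bundle onto the base. -/
def diskProj [TopologicalSpace B] [TopologicalSpace F] [FiberBundle F E] :
    C(diskBundle F E, B) where
  toFun v := v.1.proj
  continuous_toFun := (FiberBundle.continuous_proj F E).comp continuous_subtype_val

end DiskBundle

section Smooth

variable {E₁ H₁ E₂ H₂ : Type*}
  [NormedAddCommGroup E₁] [NormedSpace ℝ E₁] [TopologicalSpace H₁]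
  [NormedAddCommGroup E₂] [NormedSpace ℝ E₂] [TopologicalSpace H₂]
  (I : ModelWithCorners ℝ E₁ H₁) (J : ModelWithCorners ℝ E₂ H₂)
  {X Y : Type*} [TopologicalSpace X] [ChartedSpace H₁ X] [TopologicalSpace Y] [ChartedSpace H₂ Y]

/-- A map `f` between subsets `S ⊆ X` and `T ⊆ Y` of manifolds is smooth: it is `C^∞` within `S`
as a map to `Y`. The function `g` only serves to write `f` as a function on all of `X`: `ContMDiffOn`
on `S` does not depend on the values of `g` outside `S`. -/
def IsSmoothBetween {S : Set X} {T : Set Y} (f : S → T) : Prop :=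
  ∃ g : X → Y, ContMDiffOn I J ∞ g S ∧ ∀ x : S, g x = f x

/-- `f` restricts to a smooth embedding of the compact subset `S` with unique derivatives
(a domain with smooth boundary): a smooth injective immersion.
The values of `f` outside `S` play no role. -/
structure IsSmoothEmbeddingOn (f : X → Y) (S : Set X) : Prop where
  contMDiffOn : ContMDiffOn I J ∞ f S
  injOn : Set.InjOn f S
  injective_mfderivWithin : ∀ x ∈ S, Function.Injective (mfderivWithin I J f S x)

end Smooth

/-- A linear double disk bundle decomposition of the smooth `n`-manifold `M`.
The closed base spaces `Lp` and `Lm` have dimensions `dp` and `dm`, and `Ep`, `Em` are smooth Euclidean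
vector bundles over them, of ranks `kp` and `km`. Their closed unit disk bundles are smoothly
embedded in `M` by `jp` and `jm`; the images cover `M` and meet exactly in the image of the boundary,
along which they are attached by the diffeomorphism `φ` of the two sphere bundles. The base spaces
sit in the disk bundles, and so in `M`, as the zero sections. -/
structure LDDBD (n dp kp dm km : ℕ)
    (M : Type*) [TopologicalSpace M]
    [ChartedSpace (EuclideanSpace ℝ (Fin n)) M] [IsManifold (𝓡 n) ∞ M]
    {Lp : Type*} [TopologicalSpace Lp] [CompactSpace Lp]
    [ChartedSpace (EuclideanSpace ℝ (Fin dp)) Lp] [IsManifold (𝓡 dp) ∞ Lp]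
    (Ep : Lp → Type*) [TopologicalSpace (TotalSpace (EuclideanSpace ℝ (Fin kp)) Ep)]
    [∀ b, NormedAddCommGroup (Ep b)] [∀ b, InnerProductSpace ℝ (Ep b)]
    [FiberBundle (EuclideanSpace ℝ (Fin kp)) Ep] [VectorBundle ℝ (EuclideanSpace ℝ (Fin kp)) Ep]
    [ContMDiffVectorBundle ∞ (EuclideanSpace ℝ (Fin kp)) Ep (𝓡 dp)]
    [IsContMDiffRiemannianBundle (𝓡 dp) ∞ (EuclideanSpace ℝ (Fin kp)) Ep]
    {Lm : Type*} [TopologicalSpace Lm] [CompactSpace Lm]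
    [ChartedSpace (EuclideanSpace ℝ (Fin dm)) Lm] [IsManifold (𝓡 dm) ∞ Lm]
    (Em : Lm → Type*) [TopologicalSpace (TotalSpace (EuclideanSpace ℝ (Fin km)) Em)]
    [∀ b, NormedAddCommGroup (Em b)] [∀ b, InnerProductSpace ℝ (Em b)]
    [FiberBundle (EuclideanSpace ℝ (Fin km)) Em] [VectorBundle ℝ (EuclideanSpace ℝ (Fin km)) Em]
    [ContMDiffVectorBundle ∞ (EuclideanSpace ℝ (Fin km)) Em (𝓡 dm)]
    [IsContMDiffRiemannianBundle (𝓡 dm) ∞ (EuclideanSpace ℝ (Fin km)) Em] where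
  one_le_kp : 1 ≤ kp
  one_le_km : 1 ≤ km
  dim_p : dp + kp = n
  dim_m : dm + km = n
  /-- The embedding of the first disk bundle in `M`. -/
  jp : TotalSpace (EuclideanSpace ℝ (Fin kp)) Ep → M
  /-- The embedding of the second disk bundle in `M`. -/
  jm : TotalSpace (EuclideanSpace ℝ (Fin km)) Em → M
  jp_embedding : IsSmoothEmbeddingOn ((𝓡 dp).prod (𝓡 kp)) (𝓡 n) jp (diskBundle _ Ep)
  jm_embedding : IsSmoothEmbeddingOn ((𝓡 dm).prod (𝓡 km)) (𝓡 n) jm (diskBundle _ Em)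
  /-- The attaching map. -/
  φ : sphereBundle (EuclideanSpace ℝ (Fin kp)) Ep ≃ₜ sphereBundle (EuclideanSpace ℝ (Fin km)) Em
  smooth_φ : IsSmoothBetween ((𝓡 dp).prod (𝓡 kp)) ((𝓡 dm).prod (𝓡 km)) φ
  smooth_φ_symm : IsSmoothBetween ((𝓡 dm).prod (𝓡 km)) ((𝓡 dp).prod (𝓡 kp)) φ.symm
  jm_φ : ∀ x, jm (φ x) = jp x
  union_eq : jp '' diskBundle _ Ep ∪ jm '' diskBundle _ Em = Set.univ
  /-- By `jm_φ`, the right side is also the image of the other sphere bundle. -/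
  inter_eq : jp '' diskBundle _ Ep ∩ jm '' diskBundle _ Em = jp '' sphereBundle _ Ep

section Kernel

variable {n dp kp dm km : ℕ}
    {M : Type*} [TopologicalSpace M]
    [ChartedSpace (EuclideanSpace ℝ (Fin n)) M] [IsManifold (𝓡 n) ∞ M]
    {Lp : Type*} [TopologicalSpace Lp] [CompactSpace Lp]
    [ChartedSpace (EuclideanSpace ℝ (Fin dp)) Lp] [IsManifold (𝓡 dp) ∞ Lp]
    {Ep : Lp → Type*} [TopologicalSpace (TotalSpace (EuclideanSpace ℝ (Fin kp)) Ep)]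
    [∀ b, NormedAddCommGroup (Ep b)] [∀ b, InnerProductSpace ℝ (Ep b)]
    [FiberBundle (EuclideanSpace ℝ (Fin kp)) Ep] [VectorBundle ℝ (EuclideanSpace ℝ (Fin kp)) Ep]
    [ContMDiffVectorBundle ∞ (EuclideanSpace ℝ (Fin kp)) Ep (𝓡 dp)]
    [IsContMDiffRiemannianBundle (𝓡 dp) ∞ (EuclideanSpace ℝ (Fin kp)) Ep]
    {Lm : Type*} [TopologicalSpace Lm] [CompactSpace Lm]
    [ChartedSpace (EuclideanSpace ℝ (Fin dm)) Lm] [IsManifold (𝓡 dm) ∞ Lm]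
    {Em : Lm → Type*} [TopologicalSpace (TotalSpace (EuclideanSpace ℝ (Fin km)) Em)]
    [∀ b, NormedAddCommGroup (Em b)] [∀ b, InnerProductSpace ℝ (Em b)]
    [FiberBundle (EuclideanSpace ℝ (Fin km)) Em] [VectorBundle ℝ (EuclideanSpace ℝ (Fin km)) Em]
    [ContMDiffVectorBundle ∞ (EuclideanSpace ℝ (Fin km)) Em (𝓡 dm)]
    [IsContMDiffRiemannianBundle (𝓡 dm) ∞ (EuclideanSpace ℝ (Fin km)) Em]

/-- The subgroup `i₊_* (Ker (i₋_* ∘ φ_*))` of the fundamental group of the first disk bundle,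
at a base point `x` on its boundary. -/
noncomputable def LDDBD.imageOfKernel (D : LDDBD n dp kp dm km M Ep Em)
    (x : sphereBundle (EuclideanSpace ℝ (Fin kp)) Ep) :
    Subgroup (FundamentalGroup (diskBundle (EuclideanSpace ℝ (Fin kp)) Ep)
      (boundaryIncl (EuclideanSpace ℝ (Fin kp)) Ep x)) :=
  Subgroup.map (FundamentalGroup.map (boundaryIncl (EuclideanSpace ℝ (Fin kp)) Ep) x)
    (MonoidHom.ker
      ((FundamentalGroup.map (boundaryIncl (EuclideanSpace ℝ (Fin km)) Em) (D.φ x)).comp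
        (FundamentalGroup.map ⟨D.φ, D.φ.continuous⟩ x)))

end Kernel

end DoubleDisk

/-! Contracting the fibres identifies the fundamental group of each disk bundle with that of its
base. The sphere fibres have dimension at least one, hence are connected, so paths in the base lift
to the sphere bundle with prescribed ends. Therefore the common boundary `C` surjects on path
classes onto both disk bundles `A` and `B`. For such a gluing, van Kampen says that `π₁(C) → π₁(M)`
is onto with kernel the product of the kernels of `π₁(C) → π₁(A)` and `π₁(C) → π₁(B)`; equivalently,
`π₁(M)` is `π₁(A)` modulo the image of the second kernel. If the fibres of `B` have dimension above
two, their spheres are simply connected and the second kernel is trivial.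

Van Kampen is used through representations of the fundamental groupoid in a group (`PathRep`). This
suits bases and manifolds that need not be connected. Compatible representations on an open cover
glue (`PathRep.exists_glue`), because a local cocycle on a square has a primitive. Take values in
`π₁(C)` modulo the two kernels: the tautological representation extends to `A` and to `B`
(`PathRep.exists_extend`), hence glues over `M`, so a loop of `C` that dies in `M` lies in the
product of the kernels. Surjectivity is a subdivision argument (`inSet_inter_of_deformation`). A
collar deformation (`stretch`) passes from the closed pieces to open sets. The same gluing shows
that simply connected fibres give injectivity on fundamental groups
(`map_injective_of_reflectsHomotopy`). -/

section

open Set Topology unitInterval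

/-! ### Path classes and representations of the fundamental groupoid. -/

/-- Homotopy classes of paths, relative to their endpoints. -/
abbrev PathClass {X : Type*} [TopologicalSpace X] (x y : X) := Path.Homotopic.Quotient x y

open Path.Homotopic.Quotient (mk)

namespace PathClass

variable {X Y Z : Type*} [TopologicalSpace X] [TopologicalSpace Y] [TopologicalSpace Z]

theorem map_trans {x y z : X} (p : PathClass x y) (q : PathClass y z) (f : C(X, Y)) :
    (p.trans q).map f = (p.map f).trans (q.map f) := by
  induction p, q using Path.Homotopic.Quotient.ind₂ with
  | _ p q => exact congrArg mk (p.map_trans q f.continuous)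

theorem map_symm {x y : X} (p : PathClass x y) (f : C(X, Y)) :
    p.symm.map f = (p.map f).symm := by
  induction p using Path.Homotopic.Quotient.ind with
  | _ p => rfl

@[simp] theorem trans_symm_trans {x y z : X} (p : PathClass x y) (q : PathClass x z) :
    p.trans (.trans p.symm q) = q := by
  simp [← Path.Homotopic.Quotient.trans_assoc]

@[simp] theorem symm_trans_trans {x y z : X} (p : PathClass x y) (q : PathClass y z) :
    p.symm.trans (p.trans q) = q := by
  simp [← Path.Homotopic.Quotient.trans_assoc]

@[simp] theorem symm_trans_eq {x y z : X} (p : PathClass x y) (q : PathClass y z) :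
    (p.trans q).symm = q.symm.trans p.symm := by
  induction p, q using Path.Homotopic.Quotient.ind₂ with
  | _ p q => exact congrArg mk (p.trans_symm q)

@[simp] theorem symm_symm_eq {x y : X} (p : PathClass x y) : p.symm.symm = p := by
  induction p using Path.Homotopic.Quotient.ind with
  | _ p => exact congrArg mk p.symm_symm

@[simp] theorem symm_refl_eq (x : X) :
    Path.Homotopic.Quotient.symm (.refl x) = .refl x := rfl

end PathClass

/-- The corestriction of a path to a subset that contains its range. -/
def Path.restrict {X : Type*} [TopologicalSpace X] {U : Set X} {x y : X} (p : Path x y)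
    (h : ∀ t, p t ∈ U) :
    Path (⟨x, by simpa using h 0⟩ : U) ⟨y, by simpa using h 1⟩ where
  toFun t := ⟨p t, h t⟩
  continuous_toFun := p.continuous.subtype_mk h
  source' := by simp
  target' := by simp

/-- A property of path classes which is stable under composition and holds for all paths
inside a member of an open cover holds for all path classes. -/
theorem PathClass.induction_on_cover {X ι : Type*} [TopologicalSpace X] {U : ι → Set X}
    (hU : ∀ i, IsOpen (U i)) (hcov : ∀ x, ∃ i, x ∈ U i)
    {P : ∀ {x y : X}, PathClass x y → Prop}
    (htrans : ∀ {x y z : X} (p : PathClass x y) (q : PathClass y z), P p → P q → P (p.trans q))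
    (hsmall : ∀ (i : ι) {x y : X} (p : Path x y), (∀ t, p t ∈ U i) → P (mk p))
    {x y : X} (p : PathClass x y) : P p := by
  induction p using Path.Homotopic.Quotient.ind with
  | _ p =>
  -- Lebesgue subdivision: `t` rises from `0`, equals `1` from index `m` on, and each piece stays in
  -- one member of the cover.
  obtain ⟨t, ht0, htm, ⟨m, hm⟩, ht⟩ := exists_monotone_Icc_subset_open_cover_unitInterval
    (c := fun i => p ⁻¹' U i) (fun i => (hU i).preimage p.continuous)
    (fun s _ => by simpa using hcov (p s))
  have small : ∀ n, P (mk (p.subpath (t n) (t (n + 1)))) := fun n => by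
    obtain ⟨i, hi⟩ := ht n
    refine hsmall i _ fun s => ?_
    have : p.subpath (t n) (t (n + 1)) s ∈ range (p.subpath (t n) (t (n + 1))) := ⟨s, rfl⟩
    rw [Path.range_subpath_of_le _ _ _ (htm n.le_succ)] at this
    obtain ⟨r, hr, hr'⟩ := this
    rw [← hr']
    exact hi hr
  have step : ∀ n, P (mk (p.subpath (t 0) (t (n + 1)))) := fun n => by
    induction n with
    | zero => exact small 0
    | succ n ih =>
      have : mk (p.subpath (t 0) (t (n + 1 + 1))) =
          Path.Homotopic.Quotient.trans (mk (p.subpath (t 0) (t (n + 1))))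
            (mk (p.subpath (t (n + 1)) (t (n + 1 + 1)))) :=
        (Path.Homotopic.Quotient.eq.2 ⟨Path.Homotopy.subpathTransSubpath p _ _ _⟩).symm
      rw [this]
      exact htrans _ _ ih (small _)
  -- `step m` ends at `t (m + 1)`, which is still `1`; this also covers `m = 0`.
  have key := step m
  rw [ht0, hm (m + 1) m.le_succ, Path.subpath_zero_one] at key
  have cast : ∀ {x' y' : X} (hx : x' = x) (hy : y' = y), P (mk (p.cast hx hy)) → P (mk p) := by
    rintro _ _ rfl rfl h; exact h
  exact cast _ _ key

/-- A representation of the fundamental groupoid of `X` in a group, that is, a functor to the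
one-object groupoid of `G`. -/
structure PathRep (X : Type*) [TopologicalSpace X] (G : Type*) [Group G] where
  /-- The value at a path class. -/
  val : ∀ {x y : X}, PathClass x y → G
  val_trans : ∀ {x y z : X} (p : PathClass x y) (q : PathClass y z),
    val (p.trans q) = val p * val q

namespace PathRep

variable {X Y G H : Type*} [TopologicalSpace X] [TopologicalSpace Y] [Group G] [Group H]

@[simp] theorem val_refl (Φ : PathRep X G) (x : X) : Φ.val (.refl x) = 1 := by
  have := Φ.val_trans (.refl x) (.refl x)
  simpa using this

@[simp] theorem val_symm (Φ : PathRep X G) {x y : X} (p : PathClass x y) :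
    Φ.val p.symm = (Φ.val p)⁻¹ := by
  have := Φ.val_trans p p.symm
  rw [Path.Homotopic.Quotient.trans_symm, val_refl] at this
  exact (inv_eq_of_mul_eq_one_right this.symm).symm

/-- The pullback of a representation under a continuous map. -/
def comap (Φ : PathRep Y G) (f : C(X, Y)) : PathRep X G where
  val p := Φ.val (p.map f)
  val_trans p q := by rw [PathClass.map_trans, Φ.val_trans]

/-- The composition of a representation with a group homomorphism. -/
def mapGroup (Φ : PathRep X G) (f : G →* H) : PathRep X H where
  val p := f (Φ.val p)
  val_trans p q := by rw [Φ.val_trans, map_mul]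

/-- Paths with the same underlying function have the same value, even if their endpoints are only
propositionally equal. -/
theorem val_congr (Φ : PathRep X G) {x y x' y' : X} (p : Path x y) (q : Path x' y')
    (h : ∀ t, p t = q t) : Φ.val (Path.Homotopic.Quotient.mk p) = Φ.val (Path.Homotopic.Quotient.mk q) := by
  obtain rfl : x = x' := by simpa using h 0
  obtain rfl : y = y' := by simpa using h 1
  obtain rfl : p = q := by ext t; exact h t
  rfl

end PathRep

/-! ### Gluing representations over an open cover. -/

/-- A local cocycle on a star-shaped set is a coboundary (on bounded sets). -/
theorem exists_primitive_of_cocycle {E G : Type*} [NormedAddCommGroup E] [NormedSpace ℝ E]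
    [Group G] (c : E → E → G) {δ : ℝ} (hδ : 0 < δ)
    (hc : ∀ a b d, dist a b < δ → dist a d < δ → c a b * c b d = c a d) (R : ℝ) :
    ∃ g : E → G, ∀ a b, ‖a‖ ≤ R → ‖b‖ ≤ R → dist a b < δ / 2 → g a * c a b = g b := by
  -- Cutting the radius to a point of norm at most `R` into `n` equal parts gives steps shorter than
  -- `δ / 2`.
  obtain ⟨n, hn⟩ := exists_nat_gt (R / (δ / 2))
  have hn0 : R < n * (δ / 2) := by rwa [div_lt_iff₀ (by positivity)] at hn
  -- For `n = 0` the radius `R` is negative and no point satisfies the norm bound.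
  obtain rfl | hnpos := Nat.eq_zero_or_pos n
  · refine ⟨fun _ => 1, fun a b ha => ?_⟩
    simp only [Nat.cast_zero, zero_mul] at hn0
    exact absurd (norm_nonneg a) (by linarith)
  have hn' : (0 : ℝ) < n := by exact_mod_cast hnpos
  let pt : E → ℕ → E := fun a k => ((k : ℝ) / n) • a
  let g : E → ℕ → G := fun a k => ((List.range k).map fun j => c (pt a j) (pt a (j + 1))).prod
  have hg : ∀ a k, g a (k + 1) = g a k * c (pt a k) (pt a (k + 1)) := fun a k => by
    simp [g, List.range_succ]
  have hstep : ∀ a k, ‖a‖ ≤ R → dist (pt a k) (pt a (k + 1)) < δ / 2 := fun a k ha => by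
    rw [dist_eq_norm, ← sub_smul, norm_smul]
    have : ((k : ℝ) / n - ((k + 1 : ℕ) : ℝ) / n) = - (1 / n) := by push_cast; ring
    rw [this, norm_neg, Real.norm_of_nonneg (by positivity), div_mul_eq_mul_div, one_mul,
      div_lt_iff₀ hn']
    linarith
  have hside : ∀ a b k, k ≤ n → dist a b < δ / 2 → dist (pt a k) (pt b k) < δ / 2 :=
    fun a b k hk hab => by
      rw [dist_smul₀, Real.norm_of_nonneg (by positivity)]
      have : (k : ℝ) / n ≤ 1 := by rw [div_le_one hn']; exact_mod_cast hk
      nlinarith [dist_nonneg (x := a) (y := b)]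
  have hself : ∀ a, c a a = 1 := fun a => by
    have := hc a a a (by simpa) (by simpa)
    simpa using this
  refine ⟨fun a => g a n, fun a b ha hb hab => ?_⟩
  -- A ladder between the two radial chains: each rung square is split by the diagonal from `pt a k`
  -- to `pt b (k + 1)`, and the cocycle identity holds on both triangles.
  have key : ∀ k ≤ n, g a k * c (pt a k) (pt b k) = g b k := fun k => by
    induction k with
    | zero => intro _; simp [g, pt, hself]
    | succ k ih =>
      intro hk
      have h1 := hstep a k ha
      have h2 := hstep b k hb
      have h3 := hside a b k (by omega) hab
      have h4 := hside a b (k + 1) hk hab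
      have h5 : dist (pt a k) (pt b (k + 1)) < δ :=
        (dist_triangle _ (pt b k) _).trans_lt (by linarith)
      rw [hg, hg, ← ih (by omega), mul_assoc, mul_assoc, hc _ _ _ (by linarith) h5,
        hc _ _ _ (by linarith) h5]
  have := key n le_rfl
  simpa [pt, div_self hn'.ne'] using this

namespace PathRep

section Glue

variable {X G ι : Type*} [TopologicalSpace X] [Group G] {U : ι → Set X}

open Classical in
/-- The value of a compatible family of representations at a path inside a member of the cover. -/
noncomputable def smallVal (Φ : ∀ i, PathRep (U i) G) {x y : X} (p : Path x y) : G :=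
  if h : ∃ i, ∀ t, p t ∈ U i then (Φ h.choose).val (.mk (p.restrict h.choose_spec)) else 1

/-- Two representations of members of the cover agree on the paths in the intersection. -/
def Compatible (Φ : ∀ i, PathRep (U i) G) : Prop :=
  ∀ i j {x y : X} (p : Path x y) (hi : ∀ t, p t ∈ U i) (hj : ∀ t, p t ∈ U j),
    (Φ i).val (.mk (p.restrict hi)) = (Φ j).val (.mk (p.restrict hj))

variable {Φ : ∀ i, PathRep (U i) G}

theorem smallVal_eq (hΦ : Compatible Φ) {x y : X} (p : Path x y) {i : ι} (hi : ∀ t, p t ∈ U i) :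
    smallVal Φ p = (Φ i).val (.mk (p.restrict hi)) := by
  have h : ∃ i, ∀ t, p t ∈ U i := ⟨i, hi⟩
  rw [smallVal, dif_pos h]
  exact hΦ _ _ _ _ _

theorem smallVal_congr {x y x' y' : X} (p : Path x y) (q : Path x' y') (h : ∀ t, p t = q t) :
    smallVal Φ p = smallVal Φ q := by
  obtain rfl : x = x' := by simpa using h 0
  obtain rfl : y = y' := by simpa using h 1
  obtain rfl : p = q := by ext t; exact h t
  rfl

theorem smallVal_const (hΦ : Compatible Φ) (hcov : ∀ x, ∃ i, x ∈ U i) {x y : X} (p : Path x y)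
    (h : ∀ t, p t = x) : smallVal Φ p = 1 := by
  obtain ⟨i, hi⟩ := hcov x
  rw [smallVal_congr p (.refl x) h, smallVal_eq hΦ _ (i := i) fun _ => hi]
  exact (Φ i).val_refl ⟨x, hi⟩

/-- The straight path between two points of a normed space. -/
def segmentPath {E : Type*} [NormedAddCommGroup E] [NormedSpace ℝ E] (a b : E) : Path a b where
  toFun t := AffineMap.lineMap a b (t : ℝ)
  continuous_toFun := by fun_prop
  source' := by simp
  target' := by simp

/-- All three segments run in a contractible set that `K` maps into a single `U i`, so the broken
path and the straight one have the same class there. -/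
theorem smallVal_segment_mul {E : Type*} [NormedAddCommGroup E] [NormedSpace ℝ E]
    (hΦ : Compatible Φ) (K : C(E, X)) {B : Set E} (hB : Convex ℝ B) {i : ι}
    (hi : ∀ b ∈ B, K b ∈ U i) {a b d : E} (ha : a ∈ B) (hb : b ∈ B) (hd : d ∈ B) :
    smallVal Φ ((segmentPath a b).map K.continuous) *
      smallVal Φ ((segmentPath b d).map K.continuous) =
      smallVal Φ ((segmentPath a d).map K.continuous) := by
  let KB : C(B, U i) := ⟨fun b => ⟨K b, hi b b.2⟩, by fun_prop⟩
  have hmem : ∀ {a b : E}, a ∈ B → b ∈ B → ∀ t, segmentPath a b t ∈ B := fun ha hb t =>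
    hB.lineMap_mem ha hb t.2
  have hval : ∀ {a b : E} (ha : a ∈ B) (hb : b ∈ B),
      smallVal Φ ((segmentPath a b).map K.continuous) =
        ((Φ i).comap KB).val (.mk ((segmentPath a b).restrict (hmem ha hb))) := fun ha hb =>
    smallVal_eq hΦ _ (i := i) fun t => hi _ (hmem ha hb t)
  have : ContractibleSpace B := hB.contractibleSpace ⟨a, ha⟩
  rw [hval ha hb, hval hb hd, hval ha hd, ← PathRep.val_trans]
  exact congrArg _ (Subsingleton.elim _ _)

/-- By the Lebesgue number lemma short segments of the square go into one member of the cover, so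
their values form a local cocycle, to which `exists_primitive_of_cocycle` applies. -/
theorem exists_primitive_square (hΦ : Compatible Φ) (hU : ∀ i, IsOpen (U i))
    (hcov : ∀ x, ∃ i, x ∈ U i) (F : C(I × I, X)) :
    ∃ g : I × I → G, ∃ ε > 0, ∀ (a b : I × I) {x y : X} (p : Path x y),
      (∀ t, p t = F (Icc.convexComb a.1 b.1 t, Icc.convexComb a.2 b.2 t)) → dist a b < ε →
      g a * smallVal Φ p = g b := by
  -- Clamping the coordinates extends `F` to the plane, a normed space; the square lies in the ball
  -- of sup norm `1`, whence the radius `1` below.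
  let pr : ℝ → I := projIcc 0 1 zero_le_one
  have hpr : Continuous pr := continuous_projIcc
  have hprd : ∀ s t, dist (pr s) (pr t) ≤ dist s t := fun s t => by
    simpa using (LipschitzWith.projIcc (zero_le_one' ℝ)).dist_le_mul s t
  have hpre : ∀ s : I, pr s = s := fun s => projIcc_val _ s
  let K : C(ℝ × ℝ, X) := ⟨fun z => F (pr z.1, pr z.2), by fun_prop⟩
  obtain ⟨δ, hδ, hball⟩ := lebesgue_number_lemma_of_metric (s := (univ : Set (I × I)))
    isCompact_univ (c := fun i => F ⁻¹' U i) (fun i => (hU i).preimage F.continuous)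
    (fun z _ => by simpa using hcov (F z))
  have hK : ∀ a : ℝ × ℝ, ∃ i, ∀ b ∈ Metric.ball a δ, K b ∈ U i := fun a => by
    obtain ⟨i, hi⟩ := hball (pr a.1, pr a.2) (mem_univ _)
    refine ⟨i, fun b hb => hi ?_⟩
    rw [Metric.mem_ball, Prod.dist_eq, max_lt_iff] at hb ⊢
    exact ⟨(hprd _ _).trans_lt hb.1, (hprd _ _).trans_lt hb.2⟩
  obtain ⟨g, hg⟩ := exists_primitive_of_cocycle
    (fun a b : ℝ × ℝ => smallVal Φ ((segmentPath a b).map K.continuous)) hδ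
    (fun a b d hab had => by
      obtain ⟨i, hi⟩ := hK a
      exact smallVal_segment_mul hΦ K (convex_ball a δ) hi (Metric.mem_ball_self hδ)
        (by rwa [Metric.mem_ball, dist_comm]) (by rwa [Metric.mem_ball, dist_comm])) 1
  have hnorm : ∀ a : I × I, ‖((a.1 : ℝ), (a.2 : ℝ))‖ ≤ 1 := fun a => by
    rw [Prod.norm_mk, Real.norm_of_nonneg a.1.2.1, Real.norm_of_nonneg a.2.2.1]
    exact max_le a.1.2.2 a.2.2.2
  refine ⟨fun a => g (a.1, a.2), δ / 2, by positivity, fun a b x y p hp hab => ?_⟩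
  refine Eq.trans ?_ (hg (a.1, a.2) (b.1, b.2) (hnorm a) (hnorm b) hab)
  congr 1
  refine smallVal_congr _ _ fun t => ?_
  rw [hp]
  have hlin : ∀ s r : I, AffineMap.lineMap (s : ℝ) (r : ℝ) (t : ℝ) = (Icc.convexComb s r t : ℝ) :=
    fun s r => by rw [AffineMap.lineMap_apply_module, Icc.coe_convexComb]; rfl
  change _ = F (pr (AffineMap.lineMap ((a.1 : ℝ), (a.2 : ℝ)) ((b.1 : ℝ), (b.2 : ℝ)) (t : ℝ)).1,
    pr (AffineMap.lineMap ((a.1 : ℝ), (a.2 : ℝ)) ((b.1 : ℝ), (b.2 : ℝ)) (t : ℝ)).2)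
  rw [AffineMap.fst_lineMap, AffineMap.snd_lineMap, hlin, hlin, hpre, hpre]

/-- `g` is a primitive of the small values along the path `p`. -/
def Tracks (Φ : ∀ i, PathRep (U i) G) {x y : X} (p : Path x y) (g : I → G) : Prop :=
  ∃ ε > 0, ∀ s t : I, dist s t < ε → g s * smallVal Φ (p.subpath s t) = g t

/-- Such an `f` is locally constant, and the interval is connected. -/
theorem eq_of_eq_of_dist_lt {α : Type*} {f : I → α} {ε : ℝ} (hε : 0 < ε)
    (h : ∀ s t, dist s t < ε → f s = f t) (s t : I) : f s = f t := by
  refine IsLocallyConstant.apply_eq_of_preconnectedSpace ?_ s t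
  rw [IsLocallyConstant.iff_eventually_eq]
  intro r
  filter_upwards [Metric.ball_mem_nhds r hε] with u hu
  exact h u r hu

/-- The product `g t * (g' t)⁻¹` is constant, so two primitives differ by a constant left factor,
which cancels in the increment. -/
theorem Tracks.unique {x y : X} {p : Path x y} {g g' : I → G} (h : Tracks Φ p g)
    (h' : Tracks Φ p g') : (g 0)⁻¹ * g 1 = (g' 0)⁻¹ * g' 1 := by
  obtain ⟨ε, hε, h⟩ := h
  obtain ⟨ε', hε', h'⟩ := h'
  have := eq_of_eq_of_dist_lt (f := fun t => g t * (g' t)⁻¹) (lt_min hε hε') (fun s t hst => by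
    simp only [← h s t (lt_min_iff.1 hst).1, ← h' s t (lt_min_iff.1 hst).2]
    group) 0 1
  rw [inv_mul_eq_iff_eq_mul, ← mul_assoc, this]
  group

/-- A primitive on the square of the homotopy restricts to primitives along `p` and `q`. It is
constant on the other two sides, where the homotopy fixes the endpoints, so the increments agree. -/
theorem exists_tracks_homotopic (hΦ : Compatible Φ) (hU : ∀ i, IsOpen (U i))
    (hcov : ∀ x, ∃ i, x ∈ U i) {x y : X} {p q : Path x y} (h : p.Homotopic q) :
    ∃ g g', Tracks Φ p g ∧ Tracks Φ q g' ∧ (g 0)⁻¹ * g 1 = (g' 0)⁻¹ * g' 1 := by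
  obtain ⟨F⟩ := h
  obtain ⟨g, ε, hε, hg⟩ := exists_primitive_square hΦ hU hcov F.toContinuousMap
  have horiz : ∀ (r s t : I), dist s t < ε → dist (r, s) (r, t) < ε := fun r s t hst => by
    rw [Prod.dist_eq]; exact max_lt (by simpa using hε) hst
  have vert : ∀ (r s t : I), dist s t < ε → dist (s, r) (t, r) < ε := fun r s t hst => by
    rw [Prod.dist_eq]; exact max_lt hst (by simpa using hε)
  have hconst : ∀ (r : I) (z : X), (∀ s, F (s, r) = z) → g (0, r) = g (1, r) := fun r z hz =>
    eq_of_eq_of_dist_lt (f := fun s => g (s, r)) hε (fun s t hst => by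
      rw [← hg (s, r) (t, r) (.refl z) (fun u => ?_) (vert r s t hst),
        smallVal_const hΦ hcov _ fun _ => rfl, mul_one]
      simpa using (hz _).symm) 0 1
  refine ⟨fun t => g (0, t), fun t => g (1, t), ⟨ε, hε, fun s t hst => ?_⟩,
    ⟨ε, hε, fun s t hst => ?_⟩, ?_⟩
  · refine hg _ _ _ (fun u => ?_) (horiz _ s t hst)
    simp [Path.subpath]
  · refine hg _ _ _ (fun u => ?_) (horiz _ s t hst)
    simp [Path.subpath]
  · simp only [hconst 0 x (by simp), hconst 1 y (by simp)]

/-- This identifies the glued value of a path inside `U i` with its value under `Φ i`. -/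
theorem tracks_subpath_zero (hΦ : Compatible Φ) {x y : X} (p : Path x y) {i : ι}
    (hi : ∀ t, p t ∈ U i) :
    Tracks Φ p fun t => (Φ i).val (.mk ((p.restrict hi).subpath 0 t)) := by
  refine ⟨1, one_pos, fun s t _ => ?_⟩
  have : smallVal Φ (p.subpath s t) = (Φ i).val (.mk ((p.restrict hi).subpath s t)) :=
    smallVal_eq hΦ (p.subpath s t) fun u => hi (Icc.convexComb s t u)
  simp only [this]
  rw [← PathRep.val_trans]
  exact congrArg _ (Path.Homotopic.Quotient.eq.2 ⟨Path.Homotopy.subpathTransSubpath _ _ _ _⟩)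

/-- The homeomorphism of the unit interval with its left half. -/
noncomputable def leftHalf (t : I) : I := ⟨t / 2, by linarith [t.2.1], by linarith [t.2.2]⟩

/-- The homeomorphism of the unit interval with its right half. -/
noncomputable def rightHalf (t : I) : I := ⟨(1 + t) / 2, by linarith [t.2.1], by linarith [t.2.2]⟩

theorem trans_leftHalf {x y z : X} (p : Path x y) (q : Path y z) (t : I) :
    (p.trans q) (leftHalf t) = p t := by
  rw [← Path.extend_extends' _ t, ← Path.extend_extends',
    Path.extend_trans_of_le_half _ _ (by simp only [leftHalf]; linarith [t.2.2])]
  congr 1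
  simp only [leftHalf]; ring

theorem trans_rightHalf {x y z : X} (p : Path x y) (q : Path y z) (t : I) :
    (p.trans q) (rightHalf t) = q t := by
  rw [← Path.extend_extends' _ t, ← Path.extend_extends',
    Path.extend_trans_of_half_le _ _ (by simp only [rightHalf]; linarith [t.2.1])]
  congr 1
  simp only [rightHalf]; ring

/-- Applied to the two halves of the interval, this makes the increment multiplicative under
concatenation. -/
theorem Tracks.comp {x y x' y' : X} {p : Path x y} {q : Path x' y'} {g : I → G}
    (h : Tracks Φ p g) (f : I → I) (hf : ∀ s t, dist (f s) (f t) ≤ dist s t)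
    (hconv : ∀ s t u, Icc.convexComb (f s) (f t) u = f (Icc.convexComb s t u))
    (hq : ∀ t, p (f t) = q t) : Tracks Φ q (g ∘ f) := by
  obtain ⟨ε, hε, h⟩ := h
  refine ⟨ε, hε, fun s t hst => ?_⟩
  refine Eq.trans ?_ (h (f s) (f t) ((hf s t).trans_lt hst))
  refine congrArg _ (smallVal_congr _ _ fun u => ?_)
  change q (Icc.convexComb s t u) = p (Icc.convexComb (f s) (f t) u)
  rw [hconv, hq]

theorem Tracks.left {x y z : X} {p : Path x y} {q : Path y z} {g : I → G}
    (h : Tracks Φ (p.trans q) g) : Tracks Φ p (g ∘ leftHalf) := by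
  refine h.comp leftHalf (fun s t => ?_) (fun s t u => ?_) (trans_leftHalf p q)
  · rw [Subtype.dist_eq, Subtype.dist_eq, Real.dist_eq, Real.dist_eq]
    simp only [leftHalf]
    rw [← sub_div, abs_div, abs_two]
    linarith [abs_nonneg ((s : ℝ) - t)]
  · ext; simp only [Icc.coe_convexComb, leftHalf]; ring

theorem Tracks.right {x y z : X} {p : Path x y} {q : Path y z} {g : I → G}
    (h : Tracks Φ (p.trans q) g) : Tracks Φ q (g ∘ rightHalf) := by
  refine h.comp rightHalf (fun s t => ?_) (fun s t u => ?_) (trans_rightHalf p q)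
  · rw [Subtype.dist_eq, Subtype.dist_eq, Real.dist_eq, Real.dist_eq]
    simp only [rightHalf]
    rw [← sub_div, abs_div, abs_two, add_sub_add_left_eq_sub]
    linarith [abs_nonneg ((s : ℝ) - t)]
  · ext; simp only [Icc.coe_convexComb, rightHalf]; ring

/-- **Gluing of representations** (the Seifert-van Kampen theorem with values in a group):
representations of the fundamental groupoids of the members of an open cover that agree on the paths
in the intersections come from a representation of the fundamental groupoid of the whole space. -/
theorem exists_glue (hΦ : Compatible Φ) (hU : ∀ i, IsOpen (U i)) (hcov : ∀ x, ∃ i, x ∈ U i) :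
    ∃ Ψ : PathRep X G, ∀ (i : ι) {x y : X} (p : Path x y) (hi : ∀ t, p t ∈ U i),
      Ψ.val (.mk p) = (Φ i).val (.mk (p.restrict hi)) := by
  have hex : ∀ {x y : X} (p : Path x y), ∃ g, Tracks Φ p g := fun p =>
    let ⟨g, _, hg, _⟩ := exists_tracks_homotopic hΦ hU hcov (Path.Homotopic.refl p)
    ⟨g, hg⟩
  choose g hg using fun (x y : X) (p : Path x y) => hex p
  -- The glued value is the increment of any primitive along the path.
  let v : ∀ {x y : X}, Path x y → G := fun {x y} p => (g x y p 0)⁻¹ * g x y p 1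
  have hv : ∀ {x y : X} {p : Path x y} {f : I → G}, Tracks Φ p f → v p = (f 0)⁻¹ * f 1 :=
    fun h => (hg _ _ _).unique h
  refine ⟨⟨fun {x y} => Quotient.lift v fun p q hpq => ?_, fun {x y z} => ?_⟩,
    fun i x y p hi => ?_⟩
  · obtain ⟨f, f', hf, hf', heq⟩ := exists_tracks_homotopic hΦ hU hcov hpq
    rw [hv hf, hv hf', heq]
  · intro p q
    induction p, q using Path.Homotopic.Quotient.ind₂ with
    | _ p q =>
    change v (p.trans q) = v p * v q
    have h := hg _ _ (p.trans q)
    rw [hv h.left, hv h.right]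
    have e0 : leftHalf 0 = 0 := by ext; simp [leftHalf]
    have e1 : leftHalf 1 = rightHalf 0 := by ext; simp [leftHalf, rightHalf]
    have e2 : rightHalf 1 = 1 := by ext; norm_num [rightHalf]
    simp only [v, Function.comp_apply]
    rw [e0, e1, e2]
    group
  · change v p = _
    rw [hv (tracks_subpath_zero hΦ p hi)]
    have h0 : (Φ i).val (.mk ((p.restrict hi).subpath 0 0)) = 1 := by
      rw [Path.subpath_self]; exact (Φ i).val_refl _
    simp only [h0, inv_one, one_mul]
    exact (Φ i).val_congr _ _ fun t => by simp [Path.subpath]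

end Glue

end PathRep

/-! ### The representation in a vertex group, and extension along a map. -/

namespace PathRep

variable {X Y G : Type*} [TopologicalSpace X] [TopologicalSpace Y] [Group G]

/-- The conjugate of a representation by a function with values in the group. -/
def twist (Φ : PathRep X G) (m : X → G) : PathRep X G where
  val {y z} p := (m y)⁻¹ * Φ.val p * m z
  val_trans p q := by rw [Φ.val_trans]; group

open Classical in
/-- The fundamental groupoid of `X` is represented in the fundamental group at `x`. -/
theorem exists_vertexRep (x : X) : ∃ T : PathRep X (FundamentalGroup X x),
    (∀ p : PathClass x x, T.val p = (FundamentalGroup.fromPath p)⁻¹) ∧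
    ∀ {y : X} (p : PathClass y y), T.val p = 1 ∨
      ∃ τ : PathClass x y, T.val p = ((τ.trans p).trans τ.symm).symm := by
  let τ : ∀ {y : X}, Joined x y → PathClass x y := fun h => .mk h.somePath
  -- Multiplication in `FundamentalGroup` is concatenation in the opposite order, hence the
  -- reversal. The value `1` serves the path components that do not contain `x`.
  let v : ∀ {y z : X}, PathClass y z → FundamentalGroup X x := fun {y z} p =>
    if h : Joined x y ∧ Joined x z then
      (((τ h.1).trans p).trans (τ h.2).symm).symm else 1
  have hjoin : ∀ {y z : X} (p : PathClass y z), Joined y z := fun p =>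
    ⟨(Path.Homotopic.Quotient.mk_surjective p).choose⟩
  have hv : ∀ {y z : X} (p : PathClass y z) (h : Joined x y) (h' : Joined x z),
      v p = (((τ h).trans p).trans (τ h').symm).symm := fun p h h' => dif_pos ⟨h, h'⟩
  let T₀ : PathRep X (FundamentalGroup X x) := ⟨v, fun {y z w} p q => by
    by_cases h : Joined x y
    · have hz := h.trans (hjoin p)
      have hw := hz.trans (hjoin q)
      rw [hv p h hz, hv q hz hw, hv _ h hw, FundamentalGroup.mul_def]
      simp
    · have hz : ¬ Joined x z := fun hz => h (hz.trans (hjoin p).symm)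
      simp [v, h, hz]⟩
  -- The chosen path from `x` to itself need not be trivial; conjugating by it normalises the value
  -- of a loop at `x`.
  let g : FundamentalGroup X x := τ (Joined.refl x)
  refine ⟨T₀.mapGroup (MulAut.conj g).toMonoidHom, fun p => ?_, fun {y} p => ?_⟩
  · change g * v p * g⁻¹ = _
    rw [hv p (Joined.refl x) (Joined.refl x)]
    rw [FundamentalGroup.mul_def, FundamentalGroup.mul_def, FundamentalGroup.inv_def,
      FundamentalGroup.inv_def]
    simp only [g]
    simp
  · change g * v p * g⁻¹ = 1 ∨ ∃ τ : PathClass x y, g * v p * g⁻¹ = _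
    by_cases h : Joined x y
    · refine .inr ⟨.trans g.symm (τ h), ?_⟩
      rw [hv p h h]
      rw [FundamentalGroup.mul_def, FundamentalGroup.mul_def, FundamentalGroup.inv_def]
      simp
    · simp [v, h]

/-- A value of the representation in the fundamental group at a loop killed by `f`
is killed by `f`. -/
theorem map_eq_one_of_eq_conj {x y : X} {p : PathClass y y} {u : FundamentalGroup X x}
    (hu : u = 1 ∨ ∃ τ : PathClass x y, u = ((τ.trans p).trans τ.symm).symm) (f : C(X, Y))
    (hp : p.map f = .refl (f y)) : FundamentalGroup.map f x u = 1 := by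
  obtain rfl | ⟨τ, rfl⟩ := hu
  · exact map_one _
  · change Path.Homotopic.Quotient.map _ f = .refl _
    rw [PathClass.map_symm, PathClass.map_trans, PathClass.map_trans, hp, PathClass.map_symm]
    simp

end PathRep

/-- `f` is surjective on homotopy classes of paths with given endpoints. -/
def ContinuousMap.IsPathFull {X Y : Type*} [TopologicalSpace X] [TopologicalSpace Y]
    (f : C(X, Y)) : Prop :=
  ∀ ⦃s s' : X⦄ (β : PathClass (f s) (f s')), ∃ c : PathClass s s', c.map f = β

/-- Every point can be joined to the range of `f`. -/
def ContinuousMap.MeetsPathComponents {X Y : Type*} [TopologicalSpace X] [TopologicalSpace Y]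
    (f : C(X, Y)) : Prop :=
  ∀ y, ∃ s, Joined (f s) y

namespace PathRep

variable {C A G : Type*} [TopologicalSpace C] [TopologicalSpace A] [Group G]

open Classical in
/-- A representation of `C` that is trivial on the loops killed by `f` extends along `f`. -/
theorem exists_extend {f : C(C, A)} (hinj : Function.Injective f) (hfull : f.IsPathFull)
    (hmeets : f.MeetsPathComponents) (F : PathRep C G)
    (hF : ∀ {s : C} (c : PathClass s s), c.map f = .refl (f s) → F.val c = 1) :
    ∃ F' : PathRep A G, ∀ {s s' : C} (c : PathClass s s'), F'.val (c.map f) = F.val c := by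
  have hF' : ∀ {s s' : C} (c c' : PathClass s s'), c.map f = c'.map f → F.val c = F.val c' := by
    intro s s' c c' h
    have := hF (c.trans c'.symm) (by rw [PathClass.map_trans, PathClass.map_symm, h]; simp)
    rwa [F.val_trans, F.val_symm, mul_inv_eq_one] at this
  -- Every point of `A` is joined to the range by `κ`; a path class of `A` is evaluated on a lift of
  -- its transport along `κ`.
  choose r hr using hmeets
  let κ : ∀ a, PathClass (f (r a)) a := fun a => .mk (hr a).somePath
  choose l hl using hfull
  let F₀ : PathRep A G := ⟨fun {a b} β => F.val (l (((κ a).trans β).trans (κ b).symm)),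
    fun {a b d} β γ => by
      rw [← F.val_trans]
      refine hF' _ _ ?_
      rw [PathClass.map_trans, hl, hl, hl]
      simp⟩
  -- As `κ (f s)` need not be constant, `F₀` restricts to `F` only up to conjugation by `m`. The
  -- twist removes it, and injectivity of `f` makes `m` a function on the range.
  let m : C → G := fun s => F.val (l (κ (f s)))
  refine ⟨F₀.twist fun a => if h : ∃ s, f s = a then m h.choose else 1, fun {s s'} c => ?_⟩
  have hm : ∀ s, (if h : ∃ s', f s' = f s then m h.choose else 1) = m s := fun s => by
    have h : ∃ s', f s' = f s := ⟨s, rfl⟩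
    rw [dif_pos h, hinj h.choose_spec]
  change (if h : ∃ s', f s' = f s then m h.choose else 1)⁻¹ * _ *
    (if h : ∃ s'', f s'' = f s' then m h.choose else 1) = _
  rw [hm, hm]
  have : F₀.val (c.map f) = F.val (((l (κ (f s))).trans c).trans (l (κ (f s'))).symm) := by
    refine hF' _ _ ?_
    rw [hl, PathClass.map_trans, PathClass.map_trans, hl, PathClass.map_symm, hl]
  rw [this, F.val_trans, F.val_trans, F.val_symm]
  simp only [m]
  group

end PathRep

/-! ### The two halves of the Seifert-van Kampen theorem. -/

section VanKampen

variable {X A B C G : Type*} [TopologicalSpace X] [TopologicalSpace A] [TopologicalSpace B]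
  [TopologicalSpace C] [Group G]

/-- Representations of `A` and `B` that agree on `C` induce a representation of a space with an open
cover `{U, V}`, where `U`, `V` and `U ∩ V` are mapped compatibly to `A`, `B` and `C`. -/
theorem PathRep.exists_glue_two {U V : Set X} (hU : IsOpen U) (hV : IsOpen V)
    (hcov : ∀ x, x ∈ U ∨ x ∈ V) {iA : C(C, A)} {iB : C(C, B)} (rU : C(U, A)) (rV : C(V, B))
    (rW : C((U ∩ V : Set X), C)) (hrU : ∀ w, iA (rW w) = rU ⟨w, w.2.1⟩)
    (hrV : ∀ w, iB (rW w) = rV ⟨w, w.2.2⟩) (FA : PathRep A G) (FB : PathRep B G)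
    (hF : ∀ {s s' : C} (c : PathClass s s'), FA.val (c.map iA) = FB.val (c.map iB)) :
    ∃ Ψ : PathRep X G, ∀ {x y : X} (p : Path x y) (h : ∀ t, p t ∈ U),
      Ψ.val (.mk p) = FA.val (.mk ((p.restrict h).map rU.continuous)) := by
  let W : Bool → Set X := fun b => Bool.rec V U b
  let Φ : ∀ b, PathRep ↥(W b) G := fun
    | true => FA.comap rU
    | false => FB.comap rV
  have key : ∀ {x y : X} (p : Path x y) (hi : ∀ t, p t ∈ U) (hj : ∀ t, p t ∈ V),
      (FA.comap rU).val (.mk (p.restrict hi)) = (FB.comap rV).val (.mk (p.restrict hj)) := by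
    intro x y p hi hj
    let q := (p.restrict (U := U ∩ V) fun t => ⟨hi t, hj t⟩).map rW.continuous
    refine Eq.trans ?_ ((hF (.mk q)).trans ?_)
    · exact FA.val_congr ((p.restrict hi).map rU.continuous) (q.map iA.continuous)
        fun t => (hrU ⟨p t, hi t, hj t⟩).symm
    · exact FB.val_congr (q.map iB.continuous) ((p.restrict hj).map rV.continuous) fun t => hrV ⟨p t, hi t, hj t⟩
  have hΦ : PathRep.Compatible Φ := by
    rintro (_ | _) (_ | _) x y p hi hj
    · rfl
    · exact (key p hj hi).symm
    · exact key p hi hj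
    · rfl
  obtain ⟨Ψ, hΨ⟩ := PathRep.exists_glue hΦ (by rintro (_ | _); exacts [hV, hU])
    (fun x => (hcov x).elim (fun h => ⟨true, h⟩) fun h => ⟨false, h⟩)
  exact ⟨Ψ, fun p h => hΨ true p h⟩

/-- The kernel in the Seifert-van Kampen theorem, for surjections `iA` and `iB`
on fundamental groups. -/
theorem mem_ker_sup_ker_of_map_eq_refl {U V : Set X} (hU : IsOpen U) (hV : IsOpen V)
    (hcov : ∀ x, x ∈ U ∨ x ∈ V) {iA : C(C, A)} {iB : C(C, B)} (rU : C(U, A)) (rV : C(V, B))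
    (rW : C((U ∩ V : Set X), C)) (hrU : ∀ w, iA (rW w) = rU ⟨w, w.2.1⟩)
    (hrV : ∀ w, iB (rW w) = rV ⟨w, w.2.2⟩)
    (hA : Function.Injective iA) (hA' : iA.IsPathFull) (hA'' : iA.MeetsPathComponents)
    (hB : Function.Injective iB) (hB' : iB.IsPathFull) (hB'' : iB.MeetsPathComponents)
    (j : C(C, X)) (hj : ∀ s, ∃ h : j s ∈ U, rU ⟨j s, h⟩ = iA s) {x : C}
    (c : FundamentalGroup C x) (hc : FundamentalGroup.map j x c = 1) :
    c ∈ (FundamentalGroup.map iA x).ker ⊔ (FundamentalGroup.map iB x).ker := by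
  obtain ⟨T, hT, hT'⟩ := PathRep.exists_vertexRep x
  -- Modulo `K` the vertex representation is trivial on loops that die in `A` or in `B`, so it
  -- extends to both and glues over `X`. A loop that dies in `X` then has value `1`, that is, lies
  -- in `K`.
  let K := (FundamentalGroup.map iA x).ker ⊔ (FundamentalGroup.map iB x).ker
  let F := T.mapGroup (QuotientGroup.mk' K)
  obtain ⟨FA, hFA⟩ := PathRep.exists_extend hA hA' hA'' F fun c h =>
    (QuotientGroup.eq_one_iff _).2 (Subgroup.mem_sup_left (PathRep.map_eq_one_of_eq_conj (hT' c) iA h))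
  obtain ⟨FB, hFB⟩ := PathRep.exists_extend hB hB' hB'' F fun c h =>
    (QuotientGroup.eq_one_iff _).2 (Subgroup.mem_sup_right (PathRep.map_eq_one_of_eq_conj (hT' c) iB h))
  obtain ⟨Ψ, hΨ⟩ := PathRep.exists_glue_two hU hV hcov rU rV rW hrU hrV FA FB
    fun c => (hFA c).trans (hFB c).symm
  obtain ⟨p, rfl⟩ := Path.Homotopic.Quotient.mk_surjective c
  have h1 : Ψ.val (.mk (p.map j.continuous)) = 1 := by
    rw [show Path.Homotopic.Quotient.mk (p.map j.continuous) = .refl _ from hc, Ψ.val_refl]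
  rw [hΨ _ fun t => (hj _).1, FA.val_congr _ (p.map iA.continuous) fun t => (hj (p t)).2] at h1
  have h2 : F.val (.mk p) = 1 := (hFA (.mk p)).symm.trans h1
  have h3 : T.val (.mk p) ∈ K := (QuotientGroup.eq_one_iff _).1 h2
  rw [hT] at h3
  exact inv_mem_iff.1 h3

/-- The path class is represented by a path in `S`. -/
def PathClass.InSet (S : Set X) {x y : X} (γ : PathClass x y) : Prop :=
  ∃ p : Path x y, (∀ t, p t ∈ S) ∧ mk p = γ

namespace PathClass.InSet

variable {S : Set X} {x y z : X}

theorem trans {γ : PathClass x y} {δ : PathClass y z} (h : InSet S γ) (h' : InSet S δ) :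
    InSet S (Path.Homotopic.Quotient.trans γ δ) := by
  obtain ⟨p, hp, rfl⟩ := h
  obtain ⟨q, hq, rfl⟩ := h'
  refine ⟨p.trans q, fun t => ?_, rfl⟩
  rw [Path.trans_apply]
  split_ifs
  exacts [hp _, hq _]

theorem symm {γ : PathClass x y} (h : InSet S γ) : InSet S (Path.Homotopic.Quotient.symm γ) := by
  obtain ⟨p, hp, rfl⟩ := h
  exact ⟨p.symm, fun t => hp _, rfl⟩

theorem mono {S' : Set X} (hS : S ⊆ S') {γ : PathClass x y} (h : InSet S γ) : InSet S' γ := by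
  obtain ⟨p, hp, rfl⟩ := h
  exact ⟨p, fun t => hS (hp t), rfl⟩

end PathClass.InSet

open PathClass in
/-- The surjectivity in the Seifert-van Kampen theorem: if the space can be deformed, with `A ∩ B`
fixed, such that small paths move into `A` or into `B`, then all paths between points of `A ∩ B`
can be deformed into `A ∩ B` as soon as this is so for the paths in `A` and in `B`. -/
theorem inSet_inter_of_deformation {A B U V : Set X} (hU : IsOpen U) (hV : IsOpen V)
    (hcov : ∀ x, x ∈ U ∨ x ∈ V) (hAB : A ∪ B = univ)
    (ψ : C(X, X)) (Θ : (ContinuousMap.id X).Homotopy ψ)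
    (hΘ : ∀ s ∈ A ∩ B, ∀ t, Θ (t, s) = s) (hψU : ∀ x ∈ U, ψ x ∈ A) (hψV : ∀ x ∈ V, ψ x ∈ B)
    (hA : ∀ {s s' : X} (γ : PathClass s s'), s ∈ A ∩ B → s' ∈ A ∩ B → InSet A γ →
      InSet (A ∩ B) γ)
    (hB : ∀ {s s' : X} (γ : PathClass s s'), s ∈ A ∩ B → s' ∈ A ∩ B → InSet B γ →
      InSet (A ∩ B) γ)
    (hA' : ∀ a ∈ A, ∃ s ∈ A ∩ B, ∃ κ : PathClass s a, InSet A κ)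
    (hB' : ∀ b ∈ B, ∃ s ∈ A ∩ B, ∃ κ : PathClass s b, InSet B κ)
    {s s' : X} (γ : PathClass s s') (hs : s ∈ A ∩ B) (hs' : s' ∈ A ∩ B) : InSet (A ∩ B) γ := by
  -- Connecting paths that serve both sides: if `ψ y` lies in `A ∩ B`, the path is required to
  -- deform into `A` and also into `B`. The same path can then close up the pieces before and after
  -- `y`.
  let Good : ∀ {s y : X}, PathClass s (ψ y) → Prop := fun {s y} κ =>
    (ψ y ∈ A → InSet A κ) ∧ (ψ y ∈ B → InSet B κ)
  have hgood : ∀ y, ∃ s ∈ A ∩ B, ∃ κ : PathClass s (ψ y), Good κ := fun y => by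
    by_cases hy : ψ y ∈ A ∩ B
    · exact ⟨ψ y, hy, .refl _, fun h => ⟨.refl _, fun _ => h, rfl⟩, fun h => ⟨.refl _, fun _ => h, rfl⟩⟩
    · rcases (hAB ▸ mem_univ (ψ y) : ψ y ∈ A ∪ B) with h | h
      · obtain ⟨s, hs, κ, hκ⟩ := hA' _ h
        exact ⟨s, hs, κ, fun _ => hκ, fun h' => absurd ⟨h, h'⟩ hy⟩
      · obtain ⟨s, hs, κ, hκ⟩ := hB' _ h
        exact ⟨s, hs, κ, fun h' => absurd ⟨h', h⟩ hy, fun _ => hκ⟩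
  have key : ∀ {y y' : X} (γ : PathClass y y'), ∀ s ∈ A ∩ B, ∀ s' ∈ A ∩ B,
      ∀ (κ : PathClass s (ψ y)) (κ' : PathClass s' (ψ y')), Good κ → Good κ' →
      InSet (A ∩ B) ((κ.trans (γ.map ψ)).trans κ'.symm) := by
    intro y y' γ
    refine PathClass.induction_on_cover (U := fun b : Bool => Bool.rec V U b)
      (P := fun {y y'} γ => ∀ s ∈ A ∩ B, ∀ s' ∈ A ∩ B,
        ∀ (κ : PathClass s (ψ y)) (κ' : PathClass s' (ψ y')), Good κ → Good κ' →
        InSet (A ∩ B) ((κ.trans (γ.map ψ)).trans κ'.symm))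
      (by rintro (_ | _); exacts [hV, hU])
      (fun x => (hcov x).elim (fun h => ⟨true, h⟩) fun h => ⟨false, h⟩) ?_ ?_ γ
    · intro x y z p q hp hq s hs s' hs' κ κ' hκ hκ'
      obtain ⟨m, hm, μ, hμ⟩ := hgood y
      have := (hp s hs m hm κ μ hκ hμ).trans (hq m hm s' hs' μ κ' hμ hκ')
      rw [PathClass.map_trans]
      simpa using this
    · rintro (_ | _) x y p hp s hs s' hs' κ κ' hκ hκ'
      · exact hB _ hs hs' (((hκ.2 (hψV _ (by simpa using hp 0))).trans
          ⟨p.map ψ.continuous, fun t => hψV _ (hp t), rfl⟩).trans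
          (hκ'.2 (hψV _ (by simpa using hp 1))).symm)
      · exact hA _ hs hs' (((hκ.1 (hψU _ (by simpa using hp 0))).trans
          ⟨p.map ψ.continuous, fun t => hψU _ (hp t), rfl⟩).trans
          (hκ'.1 (hψU _ (by simpa using hp 1))).symm)
  -- Tracks of points of `A ∩ B` are constant, hence good; naturality of `Θ` turns the `ψ`-image
  -- conjugated by them back into `γ`.
  have hev : ∀ s ∈ A ∩ B, Good (mk (Θ.evalAt s)) := fun s hs =>
    ⟨fun _ => ⟨_, fun t => (hΘ s hs t).symm ▸ hs.1, rfl⟩,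
      fun _ => ⟨_, fun t => (hΘ s hs t).symm ▸ hs.2, rfl⟩⟩
  have := key γ s hs s' hs' _ _ (hev s hs) (hev s' hs')
  obtain ⟨p, rfl⟩ := Path.Homotopic.Quotient.mk_surjective γ
  have hnat : (mk (Θ.evalAt s)).trans ((mk p).map ψ) = (mk p).trans (mk (Θ.evalAt s')) :=
    (Path.Homotopic.Quotient.eq.2 (Path.Homotopic.map_trans_evalAt Θ p)).symm
  have hcancel : (mk p : PathClass s s') =
      ((mk p).trans (mk (Θ.evalAt s'))).trans (mk (Θ.evalAt s')).symm := by simp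
  rw [hcancel, ← hnat]
  exact this

end VanKampen

theorem Path.Homotopic.of_forall_eq {X : Type*} [TopologicalSpace X] {x y x' y' : X}
    {p q : Path x y} {p' q' : Path x' y'} (h : p.Homotopic q) (hp : ∀ t, p t = p' t)
    (hq : ∀ t, q t = q' t) : p'.Homotopic q' := by
  obtain rfl : x = x' := by simpa using hp 0
  obtain rfl : y = y' := by simpa using hp 1
  obtain rfl : p = p' := by ext t; exact hp t
  obtain rfl : q = q' := by ext t; exact hq t
  exact h

/-- Composing on both sides with constant paths does not change the class of a path. -/
theorem Path.Homotopic.trans_trans_of_const {X : Type*} [TopologicalSpace X] {x y x' y' : X}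
    (k : Path x y) (p : Path y y') (k' : Path y' x') (q : Path x x') (hk : ∀ t, k t = x)
    (hk' : ∀ t, k' t = x') (hq : ∀ t, q t = p t) : q.Homotopic ((k.trans p).trans k') := by
  obtain rfl : y = x := by simpa using hk 1
  obtain rfl : y' = x' := by simpa using hk' 0
  obtain rfl : k = .refl _ := by ext t; exact hk t
  obtain rfl : k' = .refl _ := by ext t; exact hk' t
  obtain rfl : q = p := by ext t; exact hq t
  rw [← Path.Homotopic.Quotient.eq]
  simp

/-! ### Path lifting and injectivity for locally trivial projections. -/

section Local

variable {S L ι : Type*} [TopologicalSpace S] [TopologicalSpace L]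

/-- Paths in `U` lift to paths with given endpoints. -/
def LiftsPaths (p : C(S, L)) (U : Set L) : Prop :=
  ∀ ⦃s s' : S⦄ (β : Path (p s) (p s')), (∀ t, β t ∈ U) → ∃ c : Path s s', ∀ t, p (c t) = β t

/-- Paths over `U` with homotopic projections are homotopic. -/
def ReflectsHomotopy (p : C(S, L)) (U : Set L) : Prop :=
  ∀ ⦃s s' : S⦄ (c c' : Path s s') (h : ∀ t, p (c t) ∈ U) (h' : ∀ t, p (c' t) ∈ U),
    ((c.map p.continuous).restrict h).Homotopic ((c'.map p.continuous).restrict h') →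
    c.Homotopic c'

/-- Pair `β` with a path joining the fibre coordinates and apply `N`. Only a retraction from the
product is needed, so a punctured fibre can stand in for a sphere. -/
theorem liftsPaths_of_prod {F : Type*} [TopologicalSpace F] [PathConnectedSpace F] (p : C(S, L))
    {U : Set L} (N : C(U × F, S)) (q : C(p ⁻¹' U, F)) (hpN : ∀ z, p (N z) = z.1)
    (hN : ∀ s : p ⁻¹' U, N (⟨p s, s.2⟩, q s) = s) : LiftsPaths p U := by
  intro s s' β hβ
  have hs : p s ∈ U := by simpa using hβ 0
  have hs' : p s' ∈ U := by simpa using hβ 1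
  obtain ⟨f⟩ := PathConnectedSpace.joined (q ⟨s, hs⟩) (q ⟨s', hs'⟩)
  exact ⟨(((β.restrict hβ).prod f).map N.continuous).cast (hN ⟨s, hs⟩).symm (hN ⟨s', hs'⟩).symm,
    fun t => hpN _⟩

/-- The fibre coordinates of the two paths are homotopic by simple connectedness; `N` carries the
product with the given homotopy back to `S`. -/
theorem reflectsHomotopy_of_prod {F : Type*} [TopologicalSpace F] [SimplyConnectedSpace F]
    (p : C(S, L)) {U : Set L} (N : C(U × F, S)) (q : C(p ⁻¹' U, F))
    (hN : ∀ s : p ⁻¹' U, N (⟨p s, s.2⟩, q s) = s) : ReflectsHomotopy p U := by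
  intro s s' c c' h h' hcc'
  have hq := SimplyConnectedSpace.paths_homotopic ((c.restrict (U := p ⁻¹' U) h).map q.continuous)
    ((c'.restrict (U := p ⁻¹' U) h').map q.continuous)
  have hprod := Path.Homotopic.map (hcc'.map2 (fun P Q => Path.Homotopic.prodHomotopy P Q) hq) N
  exact hprod.of_forall_eq (fun t => hN ⟨c t, h t⟩) fun t => hN ⟨c' t, h' t⟩

variable {p : C(S, L)} {U : ι → Set L}

/-- Short pieces lift with any prescribed ends, so the subdivision points may be lifted arbitrarily
and the lifts concatenate. -/
theorem isPathFull_of_liftsPaths (hp : Function.Surjective p) (hU : ∀ i, IsOpen (U i))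
    (hcov : ∀ x, ∃ i, x ∈ U i) (h : ∀ i, LiftsPaths p (U i)) : p.IsPathFull := by
  intro s s' β
  have key := PathClass.induction_on_cover hU hcov
    (P := fun {u u'} γ => ∀ s s' (hs : p s = u) (hs' : p s' = u'),
      ∃ c : PathClass s s', c.map p = γ.cast hs hs') ?_ ?_ β s s' rfl rfl
  · simpa using key
  · rintro u v w γ δ hγ hδ s s' rfl rfl
    obtain ⟨m, rfl⟩ := hp v
    obtain ⟨c, hc⟩ := hγ s m rfl rfl
    obtain ⟨d, hd⟩ := hδ m s' rfl rfl
    exact ⟨c.trans d, by rw [PathClass.map_trans, hc, hd]; simp⟩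
  · rintro i u u' γ hγ s s' rfl rfl
    obtain ⟨c, hc⟩ := h i γ hγ
    refine ⟨.mk c, ?_⟩
    rw [Path.Homotopic.Quotient.cast_rfl_rfl, ← Path.Homotopic.Quotient.mk_map]
    congr 1
    ext t
    exact hc t

/-- Sending a short path of `L` to the class of a lift is well defined and glues to a representation
of `L`. Its pullback to `S` is conjugate to the vertex representation, so a loop that dies in `L` is
already trivial. -/
theorem map_injective_of_reflectsHomotopy (hp : Function.Surjective p) (hU : ∀ i, IsOpen (U i))
    (hcov : ∀ x, ∃ i, x ∈ U i) (hl : ∀ i, LiftsPaths p (U i))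
    (hr : ∀ i, ReflectsHomotopy p (U i)) (x : S) :
    Function.Injective (FundamentalGroup.map p x) := by
  rw [injective_iff_map_eq_one]
  intro c hc
  obtain ⟨T, hT, -⟩ := PathRep.exists_vertexRep x
  -- An arbitrary set-theoretic section; lifts of paths run between its values.
  choose r hr' using hp
  have hlift : ∀ i {u u' : L} (β : Path u u'), (∀ t, β t ∈ U i) →
      ∃ c : Path (r u) (r u'), ∀ t, p (c t) = β t := fun i u u' β hβ =>
    hl i (β.cast (hr' u) (hr' u')) hβ
  choose l hl' using fun (i : ι) {u u' : U i} (β : Path u u') =>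
    hlift i (β.map continuous_subtype_val) fun t => (β t).2
  have huniq : ∀ i {u u' : U i} (β : Path u u') (c : Path (r u) (r u')),
      (∀ t, p (c t) = β t) → mk (l i β) = mk c := fun i u u' β c hc => by
    refine Path.Homotopic.Quotient.eq.2 (hr i _ _ (fun t => ?_) (fun t => ?_) ?_)
    · rw [hl']; exact (β t).2
    · rw [hc]; exact (β t).2
    · exact (Path.Homotopic.refl β).of_forall_eq (fun t => Subtype.ext (hl' i β t).symm)
        fun t => Subtype.ext (hc t).symm
  let Φ : ∀ i, PathRep (U i) (FundamentalGroup S x) := fun i =>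
    ⟨fun {u u'} => Quotient.lift (fun β => T.val (mk (l i β))) fun β β' h => by
      refine congrArg T.val (Path.Homotopic.Quotient.eq.2 (hr i _ _ (fun t => ?_) (fun t => ?_) ?_))
      · rw [hl']; exact (β t).2
      · rw [hl']; exact (β' t).2
      · exact h.of_forall_eq (fun t => Subtype.ext (hl' i β t).symm)
          fun t => Subtype.ext (hl' i β' t).symm,
    fun {u v w} β γ => by
      induction β, γ using Path.Homotopic.Quotient.ind₂ with
      | _ β γ =>
      change T.val (mk (l i (β.trans γ))) = T.val (mk (l i β)) * T.val (mk (l i γ))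
      rw [← T.val_trans, huniq i (β.trans γ) ((l i β).trans (l i γ)) fun t => ?_]
      · rfl
      · rw [Path.trans_apply, Path.trans_apply]
        split_ifs <;> exact hl' i _ _⟩
  have hΦ : PathRep.Compatible Φ := fun i j u u' β hi hj =>
    congrArg T.val (huniq i (β.restrict hi) (l j (β.restrict hj)) fun t => hl' j _ t)
  obtain ⟨Ψ, hΨ⟩ := PathRep.exists_glue hΦ hU hcov
  -- Paths inside the fibres from the chosen points to the given ones provide the conjugation.
  have hk : ∀ y : S, ∃ k : Path (r (p y)) y, ∀ t, p (k t) = p y := fun y => by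
    obtain ⟨i, hi⟩ := hcov (p y)
    exact hl i ((Path.refl (p y)).cast (hr' _) rfl) fun _ => hi
  choose k hk using hk
  have key : ∀ {y y' : S} (c : PathClass y y'),
      Ψ.val (c.map p) = T.val (mk (k y)) * T.val c * (T.val (mk (k y')))⁻¹ := by
    intro y y' c
    refine PathClass.induction_on_cover (fun i => (hU i).preimage p.continuous)
      (fun s => hcov (p s)) (P := fun {y y'} c =>
        Ψ.val (c.map p) = T.val (mk (k y)) * T.val c * (T.val (mk (k y')))⁻¹) ?_ ?_ c
    · intro y z w c d hc hd
      rw [PathClass.map_trans, Ψ.val_trans, hc, hd, T.val_trans]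
      group
    · intro i y y' c hc
      have hy : p y ∈ U i := by simpa using hc 0
      have hy' : p y' ∈ U i := by simpa using hc 1
      rw [← Path.Homotopic.Quotient.mk_map, hΨ i (c.map p.continuous) hc, ← T.val_symm,
        ← T.val_trans, ← T.val_trans]
      have h1 : ∀ t, p (((k y).trans c) t) ∈ U i := fun t => by
        rw [Path.trans_apply]; split_ifs
        exacts [(hk y _).symm ▸ hy, hc _]
      have h2 : ∀ t, p ((((k y).trans c).trans (k y').symm) t) ∈ U i := fun t => by
        rw [Path.trans_apply]; split_ifs
        exacts [h1 _, (hk y' _).symm ▸ hy']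
      have h3 : ∀ t, p (l i ((c.map p.continuous).restrict hc) t) ∈ U i := fun t => by
        rw [hl']; exact hc t
      refine congrArg T.val ((Path.Homotopic.Quotient.eq
        (q := ((k y).trans c).trans (k y').symm)).2 (hr i _ _ h3 h2 ?_))
      let K : Path (⟨p (r (p y)), (hr' (p y)).symm ▸ hy⟩ : U i) ⟨p y, hy⟩ :=
        ((k y).map p.continuous).restrict fun t => (hk y t).symm ▸ hy
      let K' : Path (⟨p y', hy'⟩ : U i) ⟨p (r (p y')), (hr' (p y')).symm ▸ hy'⟩ :=
        ((k y').symm.map p.continuous).restrict fun t => (hk y' _).symm ▸ hy'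
      refine (Path.Homotopic.trans_trans_of_const K ((c.map p.continuous).restrict hc) K'
        (((l i ((c.map p.continuous).restrict hc)).map p.continuous).restrict h3)
        (fun t => Subtype.ext ((hk y t).trans (hr' _).symm))
        (fun t => Subtype.ext ((hk y' _).trans (hr' _).symm))
        fun t => Subtype.ext (hl' i _ t)).of_forall_eq (fun t => rfl) fun t => Subtype.ext ?_
      change ((K.trans ((c.map p.continuous).restrict hc)).trans K' t : L) =
        p ((((k y).trans c).trans (k y').symm) t)
      simp only [Path.trans_apply]
      split_ifs <;> rfl
  have h1 := key (y := x) (y' := x) c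
  rw [show Path.Homotopic.Quotient.map c p = .refl _ from hc, Ψ.val_refl, eq_comm,
    mul_inv_eq_one, mul_eq_left, hT] at h1
  exact inv_eq_one.1 h1

end Local

/-! ### Simple connectedness of punctured space. -/

section SimplyConnected

open PathClass

variable {X : Type*} [TopologicalSpace X]

theorem PathClass.InSet.eq_of_isSimplyConnected {U : Set X} (hU : IsSimplyConnected U) {x y : X}
    {γ δ : PathClass x y} (hγ : InSet U γ) (hδ : InSet U δ) : γ = δ := by
  obtain ⟨p, hp, rfl⟩ := hγ
  obtain ⟨q, hq, rfl⟩ := hδ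
  have := hU.simplyConnectedSpace
  exact Path.Homotopic.Quotient.eq.2 ((SimplyConnectedSpace.paths_homotopic (p.restrict hp)
    (q.restrict hq)).map ⟨_, continuous_subtype_val⟩)

/-- A space covered by two simply connected open sets with path connected intersection
is simply connected. -/
theorem simplyConnectedSpace_of_cover {U V : Set X} (hU : IsOpen U) (hV : IsOpen V)
    (hcov : ∀ x, x ∈ U ∨ x ∈ V) (hU' : IsSimplyConnected U) (hV' : IsSimplyConnected V)
    (hUV : IsPathConnected (U ∩ V)) : SimplyConnectedSpace X := by
  obtain ⟨x, hx⟩ := hUV.nonempty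
  have inSet : ∀ {S : Set X}, IsPathConnected S → x ∈ S → ∀ y ∈ S,
      ∃ τ : PathClass x y, InSet S τ := fun {S} hS hxS y hy =>
    let h := hS.joinedIn x hxS y hy
    ⟨mk h.somePath, h.somePath, h.somePath_mem, rfl⟩
  have hex : ∀ y, ∃ τ : PathClass x y, (y ∈ U → InSet U τ) ∧ (y ∈ V → InSet V τ) := fun y => by
    by_cases hy : y ∈ U ∩ V
    · obtain ⟨τ, hτ⟩ := inSet hUV hx y hy
      exact ⟨τ, fun _ => hτ.mono inter_subset_left, fun _ => hτ.mono inter_subset_right⟩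
    · rcases hcov y with h | h
      · obtain ⟨τ, hτ⟩ := inSet hU'.isPathConnected hx.1 y h
        exact ⟨τ, fun _ => hτ, fun h' => absurd ⟨h, h'⟩ hy⟩
      · obtain ⟨τ, hτ⟩ := inSet hV'.isPathConnected hx.2 y h
        exact ⟨τ, fun h' => absurd ⟨h', h⟩ hy, fun _ => hτ⟩
  choose τ hτ using hex
  -- Within `U` or `V` a path class is determined by its ends, so it equals the detour through `x`;
  -- this form is stable under composition.
  have key : ∀ {y z : X} (γ : PathClass y z), γ = (τ y).symm.trans (τ z) := fun {y z} γ => by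
    refine PathClass.induction_on_cover (U := fun b : Bool => Bool.rec V U b)
      (P := fun {y z} γ => γ = (τ y).symm.trans (τ z)) (by rintro (_ | _); exacts [hV, hU])
      (fun x => (hcov x).elim (fun h => ⟨true, h⟩) fun h => ⟨false, h⟩) ?_ ?_ γ
    · rintro y z w p q hp hq
      rw [hp, hq]; simp
    · rintro (_ | _) y z p hp
      · exact InSet.eq_of_isSimplyConnected hV' ⟨p, hp, rfl⟩
          (((hτ y).2 (by simpa using hp 0)).symm.trans ((hτ z).2 (by simpa using hp 1)))
      · exact InSet.eq_of_isSimplyConnected hU' ⟨p, hp, rfl⟩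
          (((hτ y).1 (by simpa using hp 0)).symm.trans ((hτ z).1 (by simpa using hp 1)))
  rw [simply_connected_iff_paths_homotopic]
  refine ⟨⟨⟨x⟩, fun y z => ?_⟩, fun y z => ⟨fun p q => (key p).trans (key q).symm⟩⟩
  obtain ⟨p, -⟩ := Path.Homotopic.Quotient.mk_surjective ((τ y).symm.trans (τ z))
  exact ⟨p⟩

theorem isSimplyConnected_union {U V : Set X} (hU : IsOpen U) (hV : IsOpen V)
    (hU' : IsSimplyConnected U) (hV' : IsSimplyConnected V) (hUV : IsPathConnected (U ∩ V)) :
    IsSimplyConnected (U ∪ V) := by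
  have himage : ∀ {S : Set X}, S ⊆ U ∪ V →
      (Subtype.val '' (Subtype.val ⁻¹' S : Set ↥(U ∪ V))) = S := fun h => by
    rw [Subtype.image_preimage_coe, inter_eq_right.2 h]
  refine simplyConnectedSpace_of_cover (U := Subtype.val ⁻¹' U) (V := Subtype.val ⁻¹' V)
    (hU.preimage continuous_subtype_val) (hV.preimage continuous_subtype_val) (fun x => x.2) ?_ ?_ ?_
  · rwa [← IsEmbedding.subtypeVal.isSimplyConnected_image, himage subset_union_left]
  · rwa [← IsEmbedding.subtypeVal.isSimplyConnected_image, himage subset_union_right]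
  · rw [← preimage_inter, IsInducing.subtypeVal.isPathConnected_iff,
      himage (inter_subset_left.trans subset_union_left)]
    exact hUV

/-- The punctured space of dimension at least three is simply connected. -/
theorem isSimplyConnected_compl_singleton_zero {F : Type*} [NormedAddCommGroup F]
    [InnerProductSpace ℝ F] [FiniteDimensional ℝ F] (hF : 2 < Module.finrank ℝ F) :
    IsSimplyConnected ({0}ᶜ : Set F) := by
  have : Nontrivial F := Module.nontrivial_of_finrank_pos (R := ℝ) (by omega)
  obtain ⟨e, he⟩ := exists_norm_eq F zero_le_one
  -- By the equality case of Cauchy-Schwarz, `W e` is the complement of the closed ray opposite to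
  -- `e`. It is star-shaped about `e`, and `W e ∩ W (-e)` is the complement of a line, of
  -- codimension at least two.
  let W : F → Set F := fun e => {v | -‖v‖ < inner ℝ e v}
  have hopen : ∀ e, IsOpen (W e) := fun e => isOpen_lt (by fun_prop) (by fun_prop)
  have hW : ∀ e : F, ‖e‖ = 1 → IsSimplyConnected (W e) := fun e he => by
    have hmem : e ∈ W e := by
      change -‖e‖ < inner ℝ e e
      rw [real_inner_self_eq_norm_sq, he]; norm_num
    have hstar : StarConvex ℝ e (W e) := by
      intro v hv a b ha hb hab
      -- The strict inequality for `v` survives multiplication by `b` only if `b` is positive.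
      rcases hb.eq_or_lt with rfl | hb
      · obtain rfl : a = 1 := by linarith
        simpa using hmem
      change -‖a • e + b • v‖ < inner ℝ e (a • e + b • v)
      have hv' : -‖v‖ < inner ℝ e v := hv
      rw [inner_add_right, inner_smul_right, inner_smul_right, real_inner_self_eq_norm_sq, he]
      have h1 : ‖b • v‖ ≤ ‖a • e + b • v‖ + ‖a • e‖ := by
        have := norm_sub_le (a • e + b • v) (a • e)
        rwa [add_sub_cancel_left] at this
      rw [norm_smul, norm_smul, he, Real.norm_of_nonneg ha, Real.norm_of_nonneg hb.le] at h1
      nlinarith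
    have := hstar.contractibleSpace ⟨e, hmem⟩
    exact (inferInstance : SimplyConnectedSpace (W e))
  have hunion : W e ∪ W (-e) = {0}ᶜ := by
    ext v
    simp only [W, mem_union, mem_ofPred_eq, inner_neg_left, mem_compl_iff, mem_singleton_iff]
    refine ⟨?_, fun hv => ?_⟩
    · rintro h rfl; simp at h
    · have := norm_pos_iff.2 hv
      by_contra! h
      linarith [h.1, h.2]
  have hinter : W e ∩ W (-e) = ((Submodule.span ℝ {e} : Submodule ℝ F) : Set F)ᶜ := by
    ext v
    simp only [W, mem_inter_iff, mem_ofPred_eq, inner_neg_left, mem_compl_iff, SetLike.mem_coe,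
      Submodule.mem_span_singleton, neg_lt_neg_iff]
    rw [← abs_lt]
    have hsq : ‖v - inner ℝ e v • e‖ ^ 2 = ‖v‖ ^ 2 - inner ℝ e v ^ 2 := by
      rw [norm_sub_sq_real, inner_smul_right, norm_smul, he, real_inner_comm, mul_one,
        Real.norm_eq_abs, sq_abs]
      ring
    refine ⟨?_, fun h => ?_⟩
    · rintro h ⟨r, rfl⟩
      rw [inner_smul_right, real_inner_self_eq_norm_sq, norm_smul, he] at h
      simp at h
    · by_contra! hle
      refine h ⟨inner ℝ e v, ?_⟩
      have : ‖v‖ ^ 2 ≤ inner ℝ e v ^ 2 := by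
        rw [← sq_abs (inner ℝ e v)]; gcongr
      have h0 : ‖v - inner ℝ e v • e‖ ^ 2 = 0 := le_antisymm (by linarith) (by positivity)
      exact (sub_eq_zero.1 (norm_eq_zero.1 (pow_eq_zero_iff two_ne_zero |>.1 h0))).symm
  rw [← hunion]
  refine isSimplyConnected_union (hopen _) (hopen _) (hW e he) (hW _ (by rwa [norm_neg])) ?_
  rw [hinter]
  refine isPathConnected_compl_of_one_lt_codim ?_
  have h1 := Submodule.finrank_quotient_add_finrank (Submodule.span ℝ {e})
  rw [finrank_span_singleton (by rintro rfl; simp at he)] at h1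
  exact_mod_cast Module.lt_rank_of_lt_finrank (show 1 < Module.finrank ℝ (F ⧸ Submodule.span ℝ {e}) by omega)

end SimplyConnected

/-- A smooth Riemannian bundle is a continuous Riemannian bundle. -/
theorem IsContMDiffRiemannianBundle.isContinuousRiemannianBundle
    {EB HB B F : Type*} [NormedAddCommGroup EB] [NormedSpace ℝ EB] [TopologicalSpace HB]
    (IB : ModelWithCorners ℝ EB HB) (n : WithTop ℕ∞) [TopologicalSpace B] [ChartedSpace HB B]
    [NormedAddCommGroup F] [NormedSpace ℝ F] {E : B → Type*} [TopologicalSpace (TotalSpace F E)]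
    [∀ b, NormedAddCommGroup (E b)] [∀ b, InnerProductSpace ℝ (E b)]
    [FiberBundle F E] [VectorBundle ℝ F E] [h : IsContMDiffRiemannianBundle IB n F E] :
    IsContinuousRiemannianBundle F E := by
  obtain ⟨g, hg, hg'⟩ := h.exists_contMDiff
  exact ⟨g, hg.continuous, hg'⟩

/-! ### Topology of disk and sphere bundles. -/

namespace DoubleDisk

section Scale

variable {B F : Type*} {E : B → Type*} [∀ b, NormedAddCommGroup (E b)]
  [∀ b, InnerProductSpace ℝ (E b)]

/-- Fibrewise scalar multiplication. -/
def scale (r : ℝ) (v : TotalSpace F E) : TotalSpace F E := ⟨v.proj, r • v.snd⟩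

theorem norm_scale (r : ℝ) (v : TotalSpace F E) : ‖(scale r v).snd‖ = |r| * ‖v.snd‖ :=
  norm_smul (β := E v.proj) r v.snd

theorem scale_mem_diskBundle (t : I) (v : diskBundle F E) :
    scale (1 - t) (v : TotalSpace F E) ∈ diskBundle F E := by
  change ‖(scale _ _).snd‖ ≤ 1
  rw [norm_scale, abs_of_nonneg (sub_nonneg.2 t.2.2)]
  have h : ‖(v : TotalSpace F E).snd‖ ≤ 1 := v.2
  nlinarith [t.2.1, t.2.2, norm_nonneg (v : TotalSpace F E).snd]

end Scale

variable {B F : Type*} {E : B → Type*} [TopologicalSpace B] [NormedAddCommGroup F]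
  [InnerProductSpace ℝ F] [TopologicalSpace (TotalSpace F E)] [∀ b, NormedAddCommGroup (E b)]
  [∀ b, InnerProductSpace ℝ (E b)] [FiberBundle F E] [VectorBundle ℝ F E]

theorem continuous_scale : Continuous fun z : ℝ × TotalSpace F E => scale z.1 z.2 := by
  rw [continuous_iff_continuousAt]
  rintro ⟨r, v⟩
  rw [FiberBundle.continuousAt_totalSpace]
  have hproj : ContinuousAt (fun z : ℝ × TotalSpace F E => z.2.proj) (r, v) :=
    ((FiberBundle.continuous_proj F E).comp continuous_snd).continuousAt
  refine ⟨hproj, ?_⟩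
  let e := trivializationAt F E v.proj
  have hmem : v.proj ∈ e.baseSet := FiberBundle.mem_baseSet_trivializationAt' _
  have hev : ∀ᶠ z : ℝ × TotalSpace F E in 𝓝 (r, v), z.1 • (e z.2).2 = (e (scale z.1 z.2)).2 := by
    filter_upwards [hproj.preimage_mem_nhds (e.open_baseSet.mem_nhds hmem)] with z hz
    exact ((e.linear ℝ hz).map_smul z.1 z.2.snd).symm
  refine ContinuousAt.congr ?_ hev
  have he : ContinuousAt (fun z : ℝ × TotalSpace F E => e z.2) (r, v) :=
    (e.continuousAt (e.mem_source.2 hmem)).comp' continuousAt_snd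
  exact continuousAt_fst.smul he.snd

variable (F E) in
theorem continuous_norm_snd [IsContinuousRiemannianBundle F E] :
    Continuous fun v : TotalSpace F E => ‖v.snd‖ := by
  have h : Continuous fun v : TotalSpace F E => inner ℝ v.snd v.snd :=
    Continuous.inner_bundle (F := F) (b := TotalSpace.proj) (v := fun v => v.snd)
      (w := fun v => v.snd) continuous_id continuous_id
  simpa only [real_inner_self_eq_norm_sq, Real.sqrt_sq (norm_nonneg _)] using h.sqrt

/-- Over a small compact `K` a trivialization has operator norm below some `C`, so the disks over
`K` form a closed subset of the compact image of `K` times a ball of radius `C`. Finitely many `K`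
cover the base. -/
theorem compactSpace_diskBundle [IsContinuousRiemannianBundle F E] [CompactSpace B] [T2Space B]
    [ProperSpace F] : CompactSpace (diskBundle F E) := by
  rw [← isCompact_iff_compactSpace]
  have hclosed : IsClosed (diskBundle F E) :=
    isClosed_le (continuous_norm_snd F E) continuous_const
  have hloc : ∀ b : B, ∃ K ∈ 𝓝 b, IsCompact (diskBundle F E ∩ TotalSpace.proj ⁻¹' K) := fun b => by
    let e := trivializationAt F E b
    obtain ⟨C, -, hC⟩ := eventually_norm_trivializationAt_lt F E b
    obtain ⟨K, hK, hKsub, hKc⟩ := local_compact_nhds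
      (Filter.inter_mem (e.open_baseSet.mem_nhds (FiberBundle.mem_baseSet_trivializationAt' b)) hC)
    refine ⟨K, hK, ?_⟩
    have himage : IsCompact ((fun z : B × F => TotalSpace.mk' F z.1 (e.symm z.1 z.2)) ''
        (K ×ˢ Metric.closedBall 0 C)) :=
      (hKc.prod (isCompact_closedBall 0 C)).image_of_continuousOn
        (e.continuousOn_symm.mono (prod_mono (fun x hx => (hKsub hx).1) (subset_univ _)))
    refine himage.of_isClosed_subset
      (hclosed.inter (hKc.isClosed.preimage (FiberBundle.continuous_proj F E))) ?_
    rintro v ⟨hv, hvK : v.proj ∈ K⟩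
    have hb : v.proj ∈ e.baseSet := (hKsub hvK).1
    refine ⟨(v.proj, (e v).2), ⟨hvK, ?_⟩, ?_⟩
    · rw [mem_closedBall_zero_iff]
      have h1 : (e v).2 = e.continuousLinearMapAt ℝ v.proj v.snd := by
        exact (e.continuousLinearMapAt_apply_of_mem (R := ℝ) hb v.snd).symm
      rw [h1]
      refine (ContinuousLinearMap.le_opNorm _ _).trans ?_
      have h2 : ‖e.continuousLinearMapAt ℝ v.proj‖ < C := (hKsub hvK).2
      have h3 : ‖v.snd‖ ≤ 1 := hv
      nlinarith [norm_nonneg v.snd, norm_nonneg (e.continuousLinearMapAt ℝ v.proj)]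
    · simp only [e.symm_proj_apply v hb]
  choose K hK hKc using hloc
  obtain ⟨t, -, ht⟩ := isCompact_univ.elim_nhds_subcover K fun b _ => hK b
  refine (t.isCompact_biUnion fun b _ => hKc b).of_isClosed_subset hclosed fun v hv => ?_
  obtain ⟨b, hb, hvb⟩ := mem_iUnion₂.1 (ht (mem_univ v.proj))
  exact mem_iUnion₂.2 ⟨b, hb, hv, hvb⟩

/-- The stretching of the disk bundle by the factor `1 + t`, truncated at the boundary. -/
noncomputable def stretch [IsContinuousRiemannianBundle F E] :
    C(I × diskBundle F E, diskBundle F E) where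
  toFun z := ⟨scale ((1 + z.1) / max 1 ((1 + z.1) * ‖(z.2 : TotalSpace F E).snd‖)) z.2, by
    have h0 : (0 : ℝ) ≤ z.1 := z.1.2.1
    change ‖(scale _ _).snd‖ ≤ 1
    rw [norm_scale, abs_of_nonneg (by positivity), div_mul_eq_mul_div,
      div_le_one (by positivity)]
    exact le_max_right _ _⟩
  continuous_toFun := by
    have hn : Continuous fun z : I × diskBundle F E => ‖(z.2 : TotalSpace F E).snd‖ :=
      (continuous_norm_snd F E).comp (continuous_subtype_val.comp continuous_snd)
    refine Continuous.subtype_mk (continuous_scale.comp (Continuous.prodMk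
      (f := fun z : I × diskBundle F E =>
        (1 + (z.1 : ℝ)) / max 1 ((1 + z.1) * ‖(z.2 : TotalSpace F E).snd‖)) ?_
      (continuous_subtype_val.comp continuous_snd))) _
    refine Continuous.div (by fun_prop) (by fun_prop) fun z => ?_
    positivity

section Stretch

variable [IsContinuousRiemannianBundle F E]

theorem stretch_zero (v : diskBundle F E) : stretch (0, v) = v := by
  ext1
  have h : ‖(v : TotalSpace F E).snd‖ ≤ 1 := v.2
  change scale _ _ = _
  simp [scale, max_eq_left h]

theorem stretch_boundaryIncl (t : I) (v : sphereBundle F E) :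
    stretch (t, boundaryIncl F E v) = boundaryIncl F E v := by
  ext1
  have h : ‖(v : TotalSpace F E).snd‖ = 1 := v.2
  have h0 : (0 : ℝ) ≤ t := t.2.1
  change scale ((1 + (t : ℝ)) / max 1 ((1 + t) * ‖(v : TotalSpace F E).snd‖))
    (v : TotalSpace F E) = v
  rw [h, mul_one, max_eq_right (by linarith), div_self (by positivity)]
  simp [scale]

/-- Doubling takes such a vector beyond the unit sphere, so the truncation puts it exactly on the
sphere. -/
theorem stretch_one_mem_range {v : diskBundle F E} (hv : 1 / 2 < ‖(v : TotalSpace F E).snd‖) :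
    stretch (1, v) ∈ range (boundaryIncl F E) := by
  refine ⟨⟨stretch (1, v), ?_⟩, rfl⟩
  change ‖(scale ((1 + ((1 : I) : ℝ)) / max 1 ((1 + ((1 : I) : ℝ)) *
    ‖(v : TotalSpace F E).snd‖)) (v : TotalSpace F E)).snd‖ = 1
  rw [norm_scale, Set.Icc.coe_one, max_eq_right (by linarith), abs_of_nonneg (by positivity),
    div_mul_eq_mul_div, div_self (by positivity)]

end Stretch

theorem exists_unit [Nontrivial F] (b : B) : ∃ w : E b, ‖w‖ = 1 := by
  have : Nontrivial (E b) := (VectorBundle.continuousLinearEquivAt ℝ F E b).toEquiv.nontrivial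
  exact exists_norm_eq (E b) zero_le_one

/-- The unit ball of a fibre is convex, so a segment joins any of its vectors to a unit vector. -/
theorem meetsPathComponents_boundaryIncl [Nontrivial F] :
    (boundaryIncl F E).MeetsPathComponents := by
  rintro ⟨⟨b, v⟩, hv⟩
  obtain ⟨w, hw⟩ := exists_unit (F := F) (E := E) b
  have hw' : (TotalSpace.mk b w : TotalSpace F E) ∈ sphereBundle F E := hw
  refine ⟨⟨⟨b, w⟩, hw'⟩, ⟨⟨⟨fun t => ⟨⟨b, AffineMap.lineMap w v (t : ℝ)⟩, ?_⟩, ?_⟩, ?_, ?_⟩⟩⟩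
  · have h := (convex_closedBall (0 : E b) 1).lineMap_mem
      (mem_closedBall_zero_iff.2 hw.le) (mem_closedBall_zero_iff.2 (show ‖v‖ ≤ 1 from hv)) t.2
    exact mem_closedBall_zero_iff.1 h
  · exact ((FiberBundle.continuous_totalSpaceMk F E b).comp (by fun_prop)).subtype_mk _
  · ext1; simp [boundaryIncl]
  · ext1; simp

/-- The zero section of the disk bundle. -/
def diskZero : C(B, diskBundle F E) where
  toFun b := ⟨zeroSection F E b, (norm_zero (E := E b)).trans_le zero_le_one⟩
  continuous_toFun := (Trivialization.continuous_zeroSection ℝ).subtype_mk _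

/-- The disk bundle contracts to the zero section. -/
def diskContraction : (ContinuousMap.id (diskBundle F E)).Homotopy
    (diskZero.comp (diskProj F E)) where
  toFun z := ⟨scale (1 - z.1) z.2, scale_mem_diskBundle z.1 z.2⟩
  continuous_toFun := Continuous.subtype_mk (continuous_scale.comp (Continuous.prodMk
    (f := fun z : I × diskBundle F E => 1 - (z.1 : ℝ)) (by fun_prop)
    (continuous_subtype_val.comp continuous_snd))) _
  map_zero_left v := by ext1; simp [scale]
  map_one_left v := by
    ext1
    change scale (1 - ((1 : I) : ℝ)) (v : TotalSpace F E) = zeroSection F E v.1.proj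
    simp [scale, zeroSection]

/-- The contraction recovers a path class from its projection: conjugate the image under the zero
section by the tracks of the ends. -/
theorem diskProj_faithful {v w : diskBundle F E} {β β' : PathClass v w}
    (h : β.map (diskProj F E) = β'.map (diskProj F E)) : β = β' := by
  have key : ∀ β : PathClass v w, β = ((mk (diskContraction.evalAt v)).trans
      ((β.map (diskProj F E)).map diskZero)).trans (mk (diskContraction.evalAt w)).symm := by
    intro β
    obtain ⟨p, rfl⟩ := Path.Homotopic.Quotient.mk_surjective β
    have hnat : (mk (diskContraction.evalAt v)).trans ((mk p).map (diskZero.comp (diskProj F E))) =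
        (mk p).trans (mk (diskContraction.evalAt w)) :=
      (Path.Homotopic.Quotient.eq.2 (Path.Homotopic.map_trans_evalAt diskContraction p)).symm
    have hcancel : (mk p : PathClass v w) = ((mk p).trans (mk (diskContraction.evalAt w))).trans
        (mk (diskContraction.evalAt w)).symm := by simp
    exact hcancel.trans (congrArg (Path.Homotopic.Quotient.trans · _) hnat.symm)
  rw [key β, key β', h]

section Sphere

/-- The projection of the sphere bundle onto the base. -/
def sphereProj : C(sphereBundle F E, B) := (diskProj F E).comp (boundaryIncl F E)

theorem sphereProj_surjective [Nontrivial F] :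
    Function.Surjective (sphereProj : C(sphereBundle F E, B)) := fun b =>
  let ⟨w, hw⟩ := exists_unit (F := F) (E := E) b
  ⟨⟨⟨b, w⟩, hw⟩, rfl⟩

theorem symm_ne_zero (e : Trivialization F (π F E)) [MemTrivializationAtlas e] {b : B}
    (hb : b ∈ e.baseSet) {f : F} (hf : f ≠ 0) : e.symm b f ≠ 0 := fun h =>
  hf (by
    have h1 : (e ⟨b, e.symm b f⟩).2 = f := by rw [e.apply_mk_symm hb]
    rw [← h1, h]
    exact (e.linear ℝ hb).map_zero)

theorem apply_ne_zero (e : Trivialization F (π F E)) [MemTrivializationAtlas e]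
    {v : TotalSpace F E} (hb : v.proj ∈ e.baseSet) (hv : v.snd ≠ 0) : (e v).2 ≠ 0 := fun h =>
  hv (by
    have h0 : (e ⟨v.proj, 0⟩).2 = 0 := (e.linear ℝ hb).map_zero
    rw [← e.symm_proj_apply v hb, h, ← h0]
    exact e.symm_apply_apply_mk hb 0)

variable [IsContinuousRiemannianBundle F E]

/-- The normalised inverse of a trivialization, with values in the sphere bundle. -/
noncomputable def toSphere (e : Trivialization F (π F E)) [MemTrivializationAtlas e] :
    C(e.baseSet × ({0}ᶜ : Set F), sphereBundle F E) where
  toFun z := ⟨scale ‖e.symm z.1 (z.2 : F)‖⁻¹ ⟨z.1, e.symm z.1 (z.2 : F)⟩, by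
    change ‖(scale _ _).snd‖ = 1
    rw [norm_scale, abs_of_nonneg (by positivity)]
    exact inv_mul_cancel₀ (norm_ne_zero_iff.2 (symm_ne_zero e z.1.2 z.2.2))⟩
  continuous_toFun := by
    have h : Continuous fun z : e.baseSet × ({0}ᶜ : Set F) =>
        (TotalSpace.mk' F (z.1 : B) (e.symm z.1 (z.2 : F)) : TotalSpace F E) :=
      e.continuousOn_symm.comp_continuous (f := fun z : e.baseSet × ({0}ᶜ : Set F) =>
        ((z.1 : B), (z.2 : F))) (by fun_prop) fun z => ⟨z.1.2, mem_univ _⟩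
    refine Continuous.subtype_mk (continuous_scale.comp (Continuous.prodMk ?_ h)) _
    exact ((continuous_norm_snd F E).comp h).inv₀ fun z =>
      norm_ne_zero_iff.2 (symm_ne_zero e z.1.2 z.2.2)

/-- The fibre coordinate of a trivialization on the sphere bundle. -/
noncomputable def fiberCoord (e : Trivialization F (π F E)) [MemTrivializationAtlas e] :
    C(((sphereProj : C(sphereBundle F E, B)) ⁻¹' e.baseSet), ({0}ᶜ : Set F)) where
  toFun s := ⟨(e (s : sphereBundle F E)).2, apply_ne_zero e s.2 (norm_ne_zero_iff.1 (by
    rw [show ‖((s : sphereBundle F E) : TotalSpace F E).snd‖ = 1 from s.1.2]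
    exact one_ne_zero))⟩
  continuous_toFun := by
    refine Continuous.subtype_mk (continuous_snd.comp (e.continuousOn.comp_continuous
      (continuous_subtype_val.comp continuous_subtype_val) fun s => e.mem_source.2 s.2)) _

theorem toSphere_fiberCoord (e : Trivialization F (π F E)) [MemTrivializationAtlas e]
    (s : (sphereProj : C(sphereBundle F E, B)) ⁻¹' e.baseSet) :
    toSphere e (⟨sphereProj (s : sphereBundle F E), s.2⟩, fiberCoord e s) = s := by
  ext1
  have h : e.symm (s : sphereBundle F E).1.proj (e (s : sphereBundle F E)).2 =
    (s : sphereBundle F E).1.snd := e.symm_proj_apply _ s.2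
  have h1 : ‖(s : sphereBundle F E).1.snd‖ = 1 := s.1.2
  change scale ‖e.symm (s : sphereBundle F E).1.proj (e (s : sphereBundle F E)).2‖⁻¹
    ⟨(s : sphereBundle F E).1.proj, e.symm (s : sphereBundle F E).1.proj
      (e (s : sphereBundle F E)).2⟩ = (s : sphereBundle F E).1
  rw [h, h1]
  simp [scale]

/-- Punctured space of dimension at least two is path connected, and a trivialization followed by
normalisation retracts its product with the base set onto the sphere bundle. -/
theorem liftsPaths_sphereProj (hF : 1 < Module.finrank ℝ F) (b : B) :
    LiftsPaths (sphereProj : C(sphereBundle F E, B)) (trivializationAt F E b).baseSet := by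
  have : PathConnectedSpace ({0}ᶜ : Set F) := isPathConnected_iff_pathConnectedSpace.1
    (isPathConnected_compl_singleton_of_one_lt_rank (Module.lt_rank_of_lt_finrank hF) 0)
  exact liftsPaths_of_prod _ (toSphere (trivializationAt F E b)) (fiberCoord _)
    (fun _ => rfl) (toSphere_fiberCoord _)

theorem isPathFull_sphereProj (hF : 1 < Module.finrank ℝ F) :
    (sphereProj : C(sphereBundle F E, B)).IsPathFull := by
  have : Nontrivial F := Module.nontrivial_of_finrank_pos (R := ℝ) (by omega)
  exact isPathFull_of_liftsPaths sphereProj_surjective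
    (fun b => (trivializationAt F E b).open_baseSet)
    (fun b => ⟨b, FiberBundle.mem_baseSet_trivializationAt' b⟩) (liftsPaths_sphereProj hF)

/-- Lift the projection of the path class to the sphere bundle; `diskProj_faithful` identifies the
lift with the original class. -/
theorem isPathFull_boundaryIncl (hF : 1 < Module.finrank ℝ F) :
    (boundaryIncl F E).IsPathFull := by
  intro s s' β
  obtain ⟨c, hc⟩ := isPathFull_sphereProj hF (s := s) (s' := s') (β.map (diskProj F E))
  exact ⟨c, diskProj_faithful (Path.Homotopic.Quotient.map_comp.symm.trans hc)⟩

/-- The projection of the sphere bundle is injective on fundamental groups, and it factors through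
the inclusion. -/
theorem map_boundaryIncl_injective [FiniteDimensional ℝ F] (hF : 2 < Module.finrank ℝ F) (x : sphereBundle F E) :
    Function.Injective (FundamentalGroup.map (boundaryIncl F E) x) := by
  have : Nontrivial F := Module.nontrivial_of_finrank_pos (R := ℝ) (by omega)
  have : SimplyConnectedSpace ({0}ᶜ : Set F) := isSimplyConnected_compl_singleton_zero hF
  have h := map_injective_of_reflectsHomotopy (p := (sphereProj : C(sphereBundle F E, B)))
    sphereProj_surjective
    (fun b => (trivializationAt F E b).open_baseSet)
    (fun b => ⟨b, FiberBundle.mem_baseSet_trivializationAt' b⟩)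
    (liftsPaths_sphereProj (by omega))
    (fun b => reflectsHomotopy_of_prod _ (toSphere (trivializationAt F E b)) (fiberCoord _)
      (toSphere_fiberCoord _)) x
  intro c c' hcc'
  refine h ?_
  change Path.Homotopic.Quotient.map c ((diskProj F E).comp (boundaryIncl F E)) =
    Path.Homotopic.Quotient.map c' ((diskProj F E).comp (boundaryIncl F E))
  rw [Path.Homotopic.Quotient.map_comp, Path.Homotopic.Quotient.map_comp]
  exact congrArg (Path.Homotopic.Quotient.map · (diskProj F E)) hcc'

theorem map_diskProj_bijective (hF : 1 < Module.finrank ℝ F) (x : sphereBundle F E) :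
    Function.Bijective (FundamentalGroup.map (diskProj F E) (boundaryIncl F E x)) := by
  refine ⟨fun _ _ h => diskProj_faithful h, fun γ => ?_⟩
  obtain ⟨c, hc⟩ := isPathFull_sphereProj hF (s := x) (s' := x) γ
  exact ⟨FundamentalGroup.map (boundaryIncl F E) x c,
    Path.Homotopic.Quotient.map_comp.symm.trans hc⟩

end Sphere

end DoubleDisk

/-! ### Surjectivity on path classes, and lifting through embeddings. -/

section PathFull

variable {X Y Z : Type*} [TopologicalSpace X] [TopologicalSpace Y] [TopologicalSpace Z]

theorem ContinuousMap.IsPathFull.comp {g : C(Y, Z)} {f : C(X, Y)} (hg : g.IsPathFull)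
    (hf : f.IsPathFull) : (g.comp f).IsPathFull := by
  intro s s' γ
  obtain ⟨β, hβ⟩ := hg (s := f s) (s' := f s') γ
  obtain ⟨c, hc⟩ := hf β
  exact ⟨c, by rw [Path.Homotopic.Quotient.map_comp, hc, hβ]⟩

theorem ContinuousMap.MeetsPathComponents.comp {g : C(Y, Z)} {f : C(X, Y)}
    (hg : g.MeetsPathComponents) (hf : f.MeetsPathComponents) :
    (g.comp f).MeetsPathComponents := by
  intro z
  obtain ⟨y, hy⟩ := hg z
  obtain ⟨x, hx⟩ := hf y
  exact ⟨x, (hx.map g.continuous).trans hy⟩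

theorem Homeomorph.isPathFull (e : X ≃ₜ Y) : (e : C(X, Y)).IsPathFull := by
  intro s s' β
  obtain ⟨q, rfl⟩ := Path.Homotopic.Quotient.mk_surjective β
  refine ⟨.mk ((q.map e.symm.continuous).cast (e.symm_apply_apply s).symm
    (e.symm_apply_apply s').symm), ?_⟩
  rw [← Path.Homotopic.Quotient.mk_map]
  congr 1
  ext t
  exact e.apply_symm_apply _

theorem Homeomorph.meetsPathComponents (e : X ≃ₜ Y) : (e : C(X, Y)).MeetsPathComponents :=
  fun y => ⟨e.symm y, by simpa using Joined.refl y⟩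

theorem Homeomorph.map_fundamentalGroup_injective (e : X ≃ₜ Y) (x : X) :
    Function.Injective (FundamentalGroup.map (e : C(X, Y)) x) := by
  intro c c' h
  obtain ⟨p, rfl⟩ := Path.Homotopic.Quotient.mk_surjective c
  obtain ⟨q, rfl⟩ := Path.Homotopic.Quotient.mk_surjective c'
  have h' : (p.map e.continuous).Homotopic (q.map e.continuous) := Path.Homotopic.Quotient.eq.1 h
  exact Path.Homotopic.Quotient.eq.2 ((h'.map (e.symm : C(Y, X))).of_forall_eq
    (fun t => e.symm_apply_apply _) fun t => e.symm_apply_apply _)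

theorem Topology.IsEmbedding.exists_lift {f : C(X, Y)} (hf : IsEmbedding f) (g : C(Z, Y))
    (hg : ∀ z, g z ∈ range f) : ∃ g' : C(Z, X), ∀ z, f (g' z) = g z := by
  choose g' hg' using hg
  refine ⟨⟨g', hf.continuous_iff.2 ?_⟩, hg'⟩
  rw [show f ∘ g' = g from funext hg']
  exact g.continuous

theorem PathClass.InSet.exists_map_eq {f : C(X, Y)} (hf : IsEmbedding f) {x x' : X}
    {γ : PathClass (f x) (f x')} (hγ : InSet (range f) γ) : ∃ δ : PathClass x x', δ.map f = γ := by
  obtain ⟨p, hp, rfl⟩ := hγ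
  obtain ⟨q, hq⟩ := hf.exists_lift p.toContinuousMap hp
  refine ⟨mk ⟨q, hf.injective ((hq 0).trans p.source), hf.injective ((hq 1).trans p.target)⟩, ?_⟩
  rw [← Path.Homotopic.Quotient.mk_map]
  congr 1
  ext t
  exact hq t

theorem PathClass.inSet_range_map {x x' : X} (δ : PathClass x x') (f : C(X, Y)) :
    InSet (range f) (δ.map f) := by
  obtain ⟨p, rfl⟩ := Path.Homotopic.Quotient.mk_surjective δ
  exact ⟨p.map f.continuous, fun t => ⟨p t, rfl⟩, rfl⟩

end PathFull

/-! ### Van Kampen for a gluing with a collar. -/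

/-- A space `X` that is glued from closed subspaces `A` and `B` along `C`, together with
a deformation of `B` that fixes `C` and moves a neighbourhood of `C` into `C`. -/
structure CollaredGluing (X A B C : Type*) [TopologicalSpace X] [TopologicalSpace A]
    [TopologicalSpace B] [TopologicalSpace C] where
  iA : C(C, A)
  iB : C(C, B)
  jA : C(A, X)
  jB : C(B, X)
  isEmbedding_iA : IsEmbedding iA
  isClosedEmbedding_jA : IsClosedEmbedding jA
  isClosedEmbedding_jB : IsClosedEmbedding jB
  comm : ∀ s, jA (iA s) = jB (iB s)
  union_eq : range jA ∪ range jB = univ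
  inter_subset : range jA ∩ range jB ⊆ range (jA.comp iA)
  deform : C(I × B, B)
  deform_zero : ∀ b, deform (0, b) = b
  deform_iB : ∀ t s, deform (t, iB s) = iB s
  collar : Set B
  isOpen_collar : IsOpen collar
  iB_mem_collar : ∀ s, iB s ∈ collar
  deform_one_mem : ∀ b ∈ collar, deform (1, b) ∈ range iB

namespace CollaredGluing

variable {X A B C : Type*} [TopologicalSpace X] [TopologicalSpace A] [TopologicalSpace B]
  [TopologicalSpace C] (𝒢 : CollaredGluing X A B C)

theorem exists_of_eq {a : A} {b : B} (h : 𝒢.jA a = 𝒢.jB b) :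
    ∃ s, 𝒢.iA s = a ∧ 𝒢.iB s = b := by
  obtain ⟨s, hs⟩ := 𝒢.inter_subset ⟨⟨a, rfl⟩, ⟨b, h.symm⟩⟩
  have hs' : 𝒢.jA (𝒢.iA s) = 𝒢.jA a := hs
  exact ⟨s, 𝒢.isClosedEmbedding_jA.injective hs',
    𝒢.isClosedEmbedding_jB.injective ((𝒢.comm s).symm.trans (hs'.trans h))⟩

theorem iB_injective : Function.Injective 𝒢.iB := fun s s' h =>
  𝒢.isEmbedding_iA.injective (𝒢.isClosedEmbedding_jA.injective (by rw [𝒢.comm, 𝒢.comm, h]))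

theorem mem_or (x : X) : (∃ a, 𝒢.jA a = x) ∨ ∃ b, 𝒢.jB b = x :=
  (𝒢.union_eq ▸ mem_univ x : x ∈ range 𝒢.jA ∪ range 𝒢.jB)

theorem range_inter : range 𝒢.jA ∩ range 𝒢.jB = range (𝒢.jA.comp 𝒢.iA) := by
  refine 𝒢.inter_subset.antisymm ?_
  rintro _ ⟨s, rfl⟩
  exact ⟨⟨𝒢.iA s, rfl⟩, ⟨𝒢.iB s, (𝒢.comm s).symm⟩⟩

/-- The deformation of `B`, extended by the identity of `A`. -/
theorem exists_deformation : ∃ Θ : C(I × X, X), (∀ t a, Θ (t, 𝒢.jA a) = 𝒢.jA a) ∧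
    ∀ t b, Θ (t, 𝒢.jB b) = 𝒢.jB (𝒢.deform (t, b)) := by
  classical
  let θ : I × X → X := fun z => if h : ∃ b, 𝒢.jB b = z.2 then 𝒢.jB (𝒢.deform (z.1, h.choose))
    else z.2
  have hB : ∀ t b, θ (t, 𝒢.jB b) = 𝒢.jB (𝒢.deform (t, b)) := fun t b => by
    have h : ∃ b', 𝒢.jB b' = 𝒢.jB b := ⟨b, rfl⟩
    simp only [θ]
    rw [dif_pos h, 𝒢.isClosedEmbedding_jB.injective h.choose_spec]
  have hA : ∀ t a, θ (t, 𝒢.jA a) = 𝒢.jA a := fun t a => by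
    by_cases h : ∃ b, 𝒢.jB b = 𝒢.jA a
    · obtain ⟨b, hb⟩ := h
      obtain ⟨s, rfl, rfl⟩ := 𝒢.exists_of_eq hb.symm
      rw [← hb, hB, 𝒢.deform_iB]
    · exact dif_neg h
  refine ⟨⟨θ, ?_⟩, hA, hB⟩
  -- Continuity is checked on the two closed pieces; on the second one, the embedding `jB` provides
  -- a continuous coordinate in `B`.
  rw [← continuousOn_univ, show (univ : Set (I × X)) =
    Prod.snd ⁻¹' range 𝒢.jA ∪ Prod.snd ⁻¹' range 𝒢.jB by rw [← preimage_union, 𝒢.union_eq]; rfl]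
  refine ContinuousOn.union_of_isClosed ?_ ?_
    (𝒢.isClosedEmbedding_jA.isClosed_range.preimage continuous_snd)
    (𝒢.isClosedEmbedding_jB.isClosed_range.preimage continuous_snd)
  · refine continuousOn_snd.congr ?_
    rintro ⟨t, _⟩ ⟨a, rfl⟩
    exact hA t a
  · rw [continuousOn_iff_continuous_domRestrict]
    obtain ⟨l, hl⟩ := 𝒢.isClosedEmbedding_jB.isEmbedding.exists_lift
      (⟨fun z : (Prod.snd ⁻¹' range 𝒢.jB : Set (I × X)) => z.1.2, by fun_prop⟩ : C(_, X))
      fun z => z.2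
    have : (Prod.snd ⁻¹' range 𝒢.jB).domRestrict θ = fun z => 𝒢.jB (𝒢.deform (z.1.1, l z)) := by
      funext z
      rw [← hB, hl]
      rfl
    rw [this]
    fun_prop

/-- The open set that is deformed into `A`. -/
def nhdA : Set X := (𝒢.jB '' 𝒢.collarᶜ)ᶜ

/-- The open set that is deformed into `B`. -/
def nhdB : Set X := (range 𝒢.jA)ᶜ

theorem isOpen_nhdA : IsOpen 𝒢.nhdA :=
  (𝒢.isClosedEmbedding_jB.isClosedMap _ 𝒢.isOpen_collar.isClosed_compl).isOpen_compl

theorem isOpen_nhdB : IsOpen 𝒢.nhdB := 𝒢.isClosedEmbedding_jA.isClosed_range.isOpen_compl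

theorem jA_mem_nhdA (a : A) : 𝒢.jA a ∈ 𝒢.nhdA := by
  rintro ⟨b, hb, hab⟩
  obtain ⟨s, -, rfl⟩ := 𝒢.exists_of_eq hab.symm
  exact hb (𝒢.iB_mem_collar s)

theorem mem_nhdA_or_mem_nhdB (x : X) : x ∈ 𝒢.nhdA ∨ x ∈ 𝒢.nhdB := by
  by_cases h : x ∈ range 𝒢.jA
  · obtain ⟨a, rfl⟩ := h
    exact .inl (𝒢.jA_mem_nhdA a)
  · exact .inr h

theorem deformation_mem_range_jA {Θ : C(I × X, X)} (hA : ∀ t a, Θ (t, 𝒢.jA a) = 𝒢.jA a)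
    (hB : ∀ t b, Θ (t, 𝒢.jB b) = 𝒢.jB (𝒢.deform (t, b))) {x : X} (hx : x ∈ 𝒢.nhdA) :
    Θ (1, x) ∈ range 𝒢.jA := by
  obtain ⟨a, rfl⟩ | ⟨b, rfl⟩ := 𝒢.mem_or x
  · exact ⟨a, (hA 1 a).symm⟩
  · have hb : b ∈ 𝒢.collar := by
      by_contra h
      exact hx ⟨b, h, rfl⟩
    obtain ⟨s, hs⟩ := 𝒢.deform_one_mem b hb
    exact ⟨𝒢.iA s, by rw [hB, ← hs, 𝒢.comm]⟩

theorem deformation_mem_range_jB {Θ : C(I × X, X)}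
    (hB : ∀ t b, Θ (t, 𝒢.jB b) = 𝒢.jB (𝒢.deform (t, b))) {x : X} (hx : x ∈ 𝒢.nhdB) :
    Θ (1, x) ∈ range 𝒢.jB := by
  obtain h | ⟨b, rfl⟩ := 𝒢.mem_or x
  · exact absurd h hx
  · exact ⟨_, (hB 1 b).symm⟩

variable {𝒢}

/-- The collar deformation supplies the hypotheses of `inSet_inter_of_deformation`, and a path in
the image of `C` lifts because `C` is embedded. -/
theorem isPathFull_comp (hA : 𝒢.iA.IsPathFull) (hA' : 𝒢.iA.MeetsPathComponents)
    (hB : 𝒢.iB.IsPathFull) (hB' : 𝒢.iB.MeetsPathComponents) :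
    (𝒢.jA.comp 𝒢.iA).IsPathFull := by
  intro s s' γ
  obtain ⟨Θ, hΘA, hΘB⟩ := 𝒢.exists_deformation
  let ψ : C(X, X) := Θ.comp ((ContinuousMap.const X 1).prodMk (.id X))
  let Θ' : (ContinuousMap.id X).Homotopy ψ :=
    { toContinuousMap := Θ
      map_zero_left := fun x => by
        obtain ⟨a, rfl⟩ | ⟨b, rfl⟩ := 𝒢.mem_or x
        · exact hΘA _ _
        · exact (hΘB _ _).trans (by rw [𝒢.deform_zero]; rfl)
      map_one_left := fun x => rfl }
  have hC : ∀ {x : X}, x ∈ range 𝒢.jA ∩ range 𝒢.jB → ∃ s, 𝒢.jA (𝒢.iA s) = x := fun h => by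
    rw [𝒢.range_inter] at h; exact h
  have hCmem : ∀ s, 𝒢.jA (𝒢.iA s) ∈ range 𝒢.jA ∩ range 𝒢.jB := fun s => by
    rw [𝒢.range_inter]; exact ⟨s, rfl⟩
  have hcomm : 𝒢.jA.comp 𝒢.iA = 𝒢.jB.comp 𝒢.iB := ContinuousMap.ext 𝒢.comm
  have hCemb : IsEmbedding (𝒢.jA.comp 𝒢.iA) :=
    𝒢.isClosedEmbedding_jA.isEmbedding.comp 𝒢.isEmbedding_iA
  refine PathClass.InSet.exists_map_eq hCemb ?_
  rw [← 𝒢.range_inter]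
  refine inSet_inter_of_deformation 𝒢.isOpen_nhdA 𝒢.isOpen_nhdB 𝒢.mem_nhdA_or_mem_nhdB 𝒢.union_eq
    ψ Θ' ?_ (fun x hx => 𝒢.deformation_mem_range_jA hΘA hΘB hx)
    (fun x hx => 𝒢.deformation_mem_range_jB hΘB hx) ?_ ?_ ?_ ?_ γ (hCmem s) (hCmem s')
  · rintro x ⟨⟨a, rfl⟩, -⟩ t
    exact hΘA t a
  · intro x x' γ hx hx' hγ
    obtain ⟨s, rfl⟩ := hC hx
    obtain ⟨s', rfl⟩ := hC hx'
    obtain ⟨δ, rfl⟩ := hγ.exists_map_eq 𝒢.isClosedEmbedding_jA.isEmbedding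
    obtain ⟨c, rfl⟩ := hA δ
    rw [𝒢.range_inter]
    have h := PathClass.inSet_range_map c (𝒢.jA.comp 𝒢.iA)
    rw [Path.Homotopic.Quotient.map_comp] at h
    exact h
  · intro x x' γ hx hx' hγ
    obtain ⟨s, rfl⟩ := hC hx
    obtain ⟨s', rfl⟩ := hC hx'
    -- The type of `γ` contains the endpoints, which must be rewritten as images of points of `B`.
    revert γ
    rw [𝒢.comm, 𝒢.comm]
    intro γ hγ
    obtain ⟨δ, rfl⟩ := hγ.exists_map_eq 𝒢.isClosedEmbedding_jB.isEmbedding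
    obtain ⟨c, rfl⟩ := hB δ
    rw [𝒢.range_inter, hcomm]
    have h := PathClass.inSet_range_map c (𝒢.jB.comp 𝒢.iB)
    rw [Path.Homotopic.Quotient.map_comp] at h
    exact h
  · rintro _ ⟨a, rfl⟩
    obtain ⟨s, ⟨κ⟩⟩ := hA' a
    exact ⟨_, hCmem s, _, PathClass.inSet_range_map (.mk κ) 𝒢.jA⟩
  · rintro _ ⟨b, rfl⟩
    obtain ⟨s, ⟨κ⟩⟩ := hB' b
    exact ⟨_, 𝒢.comm s ▸ hCmem s, _, PathClass.inSet_range_map (.mk κ) 𝒢.jB⟩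

theorem map_jA_surjective (hA : 𝒢.iA.IsPathFull) (hA' : 𝒢.iA.MeetsPathComponents)
    (hB : 𝒢.iB.IsPathFull) (hB' : 𝒢.iB.MeetsPathComponents) (x : C) :
    Function.Surjective (FundamentalGroup.map 𝒢.jA (𝒢.iA x)) := fun γ => by
  obtain ⟨c, hc⟩ := isPathFull_comp hA hA' hB hB' (s := x) (s' := x) γ
  exact ⟨FundamentalGroup.map 𝒢.iA x c, Path.Homotopic.Quotient.map_comp.symm.trans hc⟩

/-- The time-one map of the deformation sends `nhdA`, `nhdB` and their intersection to `A`, `B` and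
`C`, compatibly, and fixes `A`. These are the maps needed to transfer representations to an open
cover of `X`. -/
theorem mem_ker_sup_ker (hA : 𝒢.iA.IsPathFull) (hA' : 𝒢.iA.MeetsPathComponents)
    (hB : 𝒢.iB.IsPathFull) (hB' : 𝒢.iB.MeetsPathComponents) {x : C} (c : FundamentalGroup C x)
    (hc : FundamentalGroup.map (𝒢.jA.comp 𝒢.iA) x c = 1) :
    c ∈ (FundamentalGroup.map 𝒢.iA x).ker ⊔ (FundamentalGroup.map 𝒢.iB x).ker := by
  obtain ⟨Θ, hΘA, hΘB⟩ := 𝒢.exists_deformation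
  let ψ : C(X, X) := Θ.comp ((ContinuousMap.const X 1).prodMk (.id X))
  obtain ⟨rU, hrU⟩ := 𝒢.isClosedEmbedding_jA.isEmbedding.exists_lift (ψ.restrict 𝒢.nhdA)
    fun z => 𝒢.deformation_mem_range_jA hΘA hΘB z.2
  obtain ⟨rV, hrV⟩ := 𝒢.isClosedEmbedding_jB.isEmbedding.exists_lift (ψ.restrict 𝒢.nhdB)
    fun z => 𝒢.deformation_mem_range_jB hΘB z.2
  obtain ⟨rW, hrW⟩ := (𝒢.isClosedEmbedding_jA.isEmbedding.comp 𝒢.isEmbedding_iA).exists_lift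
    (f := 𝒢.jA.comp 𝒢.iA) (ψ.restrict (𝒢.nhdA ∩ 𝒢.nhdB)) fun z =>
      𝒢.inter_subset ⟨𝒢.deformation_mem_range_jA hΘA hΘB z.2.1,
        𝒢.deformation_mem_range_jB hΘB z.2.2⟩
  refine mem_ker_sup_ker_of_map_eq_refl 𝒢.isOpen_nhdA 𝒢.isOpen_nhdB 𝒢.mem_nhdA_or_mem_nhdB rU rV rW
    (fun w => 𝒢.isClosedEmbedding_jA.injective ((hrW w).trans (hrU ⟨w, w.2.1⟩).symm))
    (fun w => 𝒢.isClosedEmbedding_jB.injective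
      ((𝒢.comm _).symm.trans ((hrW w).trans (hrV ⟨w, w.2.2⟩).symm)))
    𝒢.isEmbedding_iA.injective hA hA' 𝒢.iB_injective hB hB' (𝒢.jA.comp 𝒢.iA)
    (fun s => ⟨𝒢.jA_mem_nhdA _, 𝒢.isClosedEmbedding_jA.injective ((hrU _).trans (hΘA 1 _))⟩) c hc

/-- **The Seifert-van Kampen theorem** for a gluing along a subspace that carries the fundamental
groups of both parts. -/
theorem ker_map_jA (hA : 𝒢.iA.IsPathFull) (hA' : 𝒢.iA.MeetsPathComponents)
    (hB : 𝒢.iB.IsPathFull) (hB' : 𝒢.iB.MeetsPathComponents) (x : C) :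
    (FundamentalGroup.map 𝒢.jA (𝒢.iA x)).ker =
      (FundamentalGroup.map 𝒢.iB x).ker.map (FundamentalGroup.map 𝒢.iA x) := by
  have hmap : ∀ c : FundamentalGroup C x,
      FundamentalGroup.map 𝒢.jA (𝒢.iA x) (FundamentalGroup.map 𝒢.iA x c) =
        FundamentalGroup.map (𝒢.jA.comp 𝒢.iA) x c := fun c =>
    Path.Homotopic.Quotient.map_comp.symm
  ext α
  constructor
  · intro hα
    obtain ⟨c, rfl⟩ := hA (s := x) (s' := x) α
    have hc := mem_ker_sup_ker hA hA' hB hB' c ((hmap c).symm.trans hα)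
    -- Kernels are normal, so `c = u * v` with `u` dying in `A` and `v` dying in `B`; then `v` has
    -- the same image in `A` as `c`.
    rw [← SetLike.mem_coe, Subgroup.normal_mul] at hc
    obtain ⟨u, hu, v, hv, rfl⟩ := hc
    refine ⟨v, hv, ?_⟩
    have : FundamentalGroup.map 𝒢.iA x (u * v) = FundamentalGroup.map 𝒢.iA x v := by
      rw [map_mul, show FundamentalGroup.map 𝒢.iA x u = 1 from hu, one_mul]
    exact this.symm
  · rintro ⟨c, hc, rfl⟩
    refine (hmap c).trans ?_
    have h : FundamentalGroup.map (𝒢.jB.comp 𝒢.iB) x c = 1 :=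
      Path.Homotopic.Quotient.map_comp.trans
        ((congrArg (Path.Homotopic.Quotient.map · 𝒢.jB) hc).trans rfl)
    -- The two composites are equal maps, but their fundamental groups sit at base points that are
    -- only propositionally equal.
    have key : ∀ f g : C(C, X), f = g → FundamentalGroup.map f x c = 1 →
        FundamentalGroup.map g x c = 1 := by
      rintro f _ rfl h; exact h
    exact key _ _ (ContinuousMap.ext 𝒢.comm).symm h

end CollaredGluing

end

/-! ### Application to double disk bundles. -/

namespace DoubleDisk

section Assembly

variable {n dp kp dm km : ℕ}
    {M : Type*} [TopologicalSpace M]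
    [ChartedSpace (EuclideanSpace ℝ (Fin n)) M] [IsManifold (𝓡 n) ∞ M]
    {Lp : Type*} [TopologicalSpace Lp] [CompactSpace Lp]
    [ChartedSpace (EuclideanSpace ℝ (Fin dp)) Lp] [IsManifold (𝓡 dp) ∞ Lp]
    {Ep : Lp → Type*} [TopologicalSpace (TotalSpace (EuclideanSpace ℝ (Fin kp)) Ep)]
    [∀ b, NormedAddCommGroup (Ep b)] [∀ b, InnerProductSpace ℝ (Ep b)]
    [FiberBundle (EuclideanSpace ℝ (Fin kp)) Ep] [VectorBundle ℝ (EuclideanSpace ℝ (Fin kp)) Ep]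
    [ContMDiffVectorBundle ∞ (EuclideanSpace ℝ (Fin kp)) Ep (𝓡 dp)]
    [IsContMDiffRiemannianBundle (𝓡 dp) ∞ (EuclideanSpace ℝ (Fin kp)) Ep]
    {Lm : Type*} [TopologicalSpace Lm] [CompactSpace Lm]
    [ChartedSpace (EuclideanSpace ℝ (Fin dm)) Lm] [IsManifold (𝓡 dm) ∞ Lm]
    {Em : Lm → Type*} [TopologicalSpace (TotalSpace (EuclideanSpace ℝ (Fin km)) Em)]
    [∀ b, NormedAddCommGroup (Em b)] [∀ b, InnerProductSpace ℝ (Em b)]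
    [FiberBundle (EuclideanSpace ℝ (Fin km)) Em] [VectorBundle ℝ (EuclideanSpace ℝ (Fin km)) Em]
    [ContMDiffVectorBundle ∞ (EuclideanSpace ℝ (Fin km)) Em (𝓡 dm)]
    [IsContMDiffRiemannianBundle (𝓡 dm) ∞ (EuclideanSpace ℝ (Fin km)) Em]

/-- For rank above two the second inclusion is injective on fundamental groups, and so is the
homeomorphism `φ`; there is no kernel to map. -/
theorem LDDBD.imageOfKernel_eq_bot (D : LDDBD n dp kp dm km M Ep Em) (hm : 2 < km)
    (x : sphereBundle (EuclideanSpace ℝ (Fin kp)) Ep) : D.imageOfKernel x = ⊥ := by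
  have : IsContinuousRiemannianBundle (EuclideanSpace ℝ (Fin km)) Em :=
    IsContMDiffRiemannianBundle.isContinuousRiemannianBundle (𝓡 dm) ∞
  have hFm : 2 < Module.finrank ℝ (EuclideanSpace ℝ (Fin km)) := by simpa using hm
  have hi : Function.Injective
      (FundamentalGroup.map (boundaryIncl (EuclideanSpace ℝ (Fin km)) Em) (D.φ x)) :=
    map_boundaryIncl_injective hFm (D.φ x)
  have hφ : Function.Injective (FundamentalGroup.map ⟨D.φ, D.φ.continuous⟩ x) :=
    D.φ.map_fundamentalGroup_injective x
  have hker : ((FundamentalGroup.map (boundaryIncl (EuclideanSpace ℝ (Fin km)) Em) (D.φ x)).comp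
      (FundamentalGroup.map ⟨D.φ, D.φ.continuous⟩ x)).ker = ⊥ :=
    (MonoidHom.ker_eq_bot_iff _).2 (hi.comp hφ)
  rw [imageOfKernel, hker, Subgroup.map_bot]

variable [T2Space M] [T2Space Lp] [T2Space Lm]

/-- The gluing of two disk bundles along their boundaries, with the collar given by the vectors of
norm greater than `1 / 2`. -/
noncomputable def LDDBD.toCollaredGluing (D : LDDBD n dp kp dm km M Ep Em) :
    CollaredGluing M (diskBundle (EuclideanSpace ℝ (Fin kp)) Ep)
      (diskBundle (EuclideanSpace ℝ (Fin km)) Em)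
      (sphereBundle (EuclideanSpace ℝ (Fin kp)) Ep) :=
  have hp : IsContinuousRiemannianBundle (EuclideanSpace ℝ (Fin kp)) Ep :=
    IsContMDiffRiemannianBundle.isContinuousRiemannianBundle (𝓡 dp) ∞
  have hm : IsContinuousRiemannianBundle (EuclideanSpace ℝ (Fin km)) Em :=
    IsContMDiffRiemannianBundle.isContinuousRiemannianBundle (𝓡 dm) ∞
  -- Compactness turns the continuous injections into the Hausdorff space `M` into closed
  -- embeddings.
  have hcp : CompactSpace (diskBundle (EuclideanSpace ℝ (Fin kp)) Ep) := compactSpace_diskBundle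
  have hcm : CompactSpace (diskBundle (EuclideanSpace ℝ (Fin km)) Em) := compactSpace_diskBundle
  have hjp : Continuous ((diskBundle (EuclideanSpace ℝ (Fin kp)) Ep).domRestrict D.jp) :=
    D.jp_embedding.contMDiffOn.continuousOn.domRestrict
  have hjm : Continuous ((diskBundle (EuclideanSpace ℝ (Fin km)) Em).domRestrict D.jm) :=
    D.jm_embedding.contMDiffOn.continuousOn.domRestrict
  { iA := boundaryIncl _ Ep
    iB := (boundaryIncl _ Em).comp D.φ
    jA := ⟨_, hjp⟩
    jB := ⟨_, hjm⟩
    isEmbedding_iA :=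
      Topology.IsEmbedding.inclusion (sphereBundle_subset_diskBundle (EuclideanSpace ℝ (Fin kp)) Ep)
    isClosedEmbedding_jA := hjp.isClosedEmbedding (Set.injOn_iff_injective.1 D.jp_embedding.injOn)
    isClosedEmbedding_jB := hjm.isClosedEmbedding (Set.injOn_iff_injective.1 D.jm_embedding.injOn)
    comm := fun s => (D.jm_φ s).symm
    union_eq := by
      change Set.range ((diskBundle _ Ep).domRestrict D.jp) ∪
        Set.range ((diskBundle _ Em).domRestrict D.jm) = Set.univ
      rw [Set.range_domRestrict, Set.range_domRestrict, D.union_eq]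
    inter_subset := by
      change Set.range ((diskBundle _ Ep).domRestrict D.jp) ∩
        Set.range ((diskBundle _ Em).domRestrict D.jm) ⊆ _
      rw [Set.range_domRestrict, Set.range_domRestrict, D.inter_eq]
      rintro _ ⟨s, hs, rfl⟩
      exact ⟨⟨s, hs⟩, rfl⟩
    deform := stretch
    deform_zero := stretch_zero
    deform_iB := fun t s => stretch_boundaryIncl t (D.φ s)
    collar := {v | 1 / 2 < ‖(v : TotalSpace (EuclideanSpace ℝ (Fin km)) Em).snd‖}
    isOpen_collar := isOpen_lt continuous_const
      ((continuous_norm_snd _ Em).comp continuous_subtype_val)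
    iB_mem_collar := fun s => by
      have h : ‖((D.φ s : sphereBundle (EuclideanSpace ℝ (Fin km)) Em) :
        TotalSpace (EuclideanSpace ℝ (Fin km)) Em).snd‖ = 1 := (D.φ s).2
      change 1 / 2 < ‖((D.φ s : sphereBundle (EuclideanSpace ℝ (Fin km)) Em) :
        TotalSpace (EuclideanSpace ℝ (Fin km)) Em).snd‖
      rw [h]; norm_num
    deform_one_mem := fun b hb => by
      obtain ⟨s, hs⟩ := stretch_one_mem_range hb
      exact ⟨D.φ.symm s, by
        rw [← hs]; exact congrArg (boundaryIncl _ Em) (D.φ.apply_symm_apply s)⟩ }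

theorem LDDBD.map_comp_map_eq (D : LDDBD n dp kp dm km M Ep Em)
    (x : sphereBundle (EuclideanSpace ℝ (Fin kp)) Ep) :
    (FundamentalGroup.map (boundaryIncl (EuclideanSpace ℝ (Fin km)) Em) (D.φ x)).comp
        (FundamentalGroup.map ⟨D.φ, D.φ.continuous⟩ x) =
      FundamentalGroup.map D.toCollaredGluing.iB x :=
  MonoidHom.ext fun c => by
    obtain ⟨p, rfl⟩ := Path.Homotopic.Quotient.mk_surjective c
    rfl

theorem LDDBD.map_surjective_and_ker_eq (D : LDDBD n dp kp dm km M Ep Em) (hp : 1 < kp)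
    (hm : 1 < km) (x : sphereBundle (EuclideanSpace ℝ (Fin kp)) Ep) :
    Function.Surjective (FundamentalGroup.map D.toCollaredGluing.jA
      (boundaryIncl (EuclideanSpace ℝ (Fin kp)) Ep x)) ∧
    (FundamentalGroup.map D.toCollaredGluing.jA
      (boundaryIncl (EuclideanSpace ℝ (Fin kp)) Ep x)).ker = D.imageOfKernel x := by
  have : IsContinuousRiemannianBundle (EuclideanSpace ℝ (Fin kp)) Ep :=
    IsContMDiffRiemannianBundle.isContinuousRiemannianBundle (𝓡 dp) ∞
  have : IsContinuousRiemannianBundle (EuclideanSpace ℝ (Fin km)) Em :=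
    IsContMDiffRiemannianBundle.isContinuousRiemannianBundle (𝓡 dm) ∞
  have hFp : 1 < Module.finrank ℝ (EuclideanSpace ℝ (Fin kp)) := by simpa using hp
  have hFm : 1 < Module.finrank ℝ (EuclideanSpace ℝ (Fin km)) := by simpa using hm
  have : Nontrivial (EuclideanSpace ℝ (Fin kp)) :=
    Module.nontrivial_of_finrank_pos (R := ℝ) (by omega)
  have : Nontrivial (EuclideanSpace ℝ (Fin km)) :=
    Module.nontrivial_of_finrank_pos (R := ℝ) (by omega)
  have hA : D.toCollaredGluing.iA.IsPathFull := isPathFull_boundaryIncl hFp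
  have hA' : D.toCollaredGluing.iA.MeetsPathComponents := meetsPathComponents_boundaryIncl
  have hB : D.toCollaredGluing.iB.IsPathFull :=
    (isPathFull_boundaryIncl hFm).comp D.φ.isPathFull
  have hB' : D.toCollaredGluing.iB.MeetsPathComponents :=
    meetsPathComponents_boundaryIncl.comp D.φ.meetsPathComponents
  refine ⟨CollaredGluing.map_jA_surjective hA hA' hB hB' x, ?_⟩
  refine (CollaredGluing.ker_map_jA hA hA' hB hB' x).trans ?_
  rw [imageOfKernel, D.map_comp_map_eq x]
  rfl

end Assembly

end DoubleDisk

theorem theorem3p2 {n dp kp dm km : ℕ}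
    {M : Type*} [TopologicalSpace M] [T2Space M] [SecondCountableTopology M]
    [ChartedSpace (EuclideanSpace ℝ (Fin n)) M] [IsManifold (𝓡 n) ∞ M]
    {Lp : Type*} [TopologicalSpace Lp] [T2Space Lp] [CompactSpace Lp]
    [ChartedSpace (EuclideanSpace ℝ (Fin dp)) Lp] [IsManifold (𝓡 dp) ∞ Lp]
    {Ep : Lp → Type*} [TopologicalSpace (TotalSpace (EuclideanSpace ℝ (Fin kp)) Ep)]
    [∀ b, NormedAddCommGroup (Ep b)] [∀ b, InnerProductSpace ℝ (Ep b)]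
    [FiberBundle (EuclideanSpace ℝ (Fin kp)) Ep] [VectorBundle ℝ (EuclideanSpace ℝ (Fin kp)) Ep]
    [ContMDiffVectorBundle ∞ (EuclideanSpace ℝ (Fin kp)) Ep (𝓡 dp)]
    [IsContMDiffRiemannianBundle (𝓡 dp) ∞ (EuclideanSpace ℝ (Fin kp)) Ep]
    {Lm : Type*} [TopologicalSpace Lm] [T2Space Lm] [CompactSpace Lm]
    [ChartedSpace (EuclideanSpace ℝ (Fin dm)) Lm] [IsManifold (𝓡 dm) ∞ Lm]
    {Em : Lm → Type*} [TopologicalSpace (TotalSpace (EuclideanSpace ℝ (Fin km)) Em)]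
    [∀ b, NormedAddCommGroup (Em b)] [∀ b, InnerProductSpace ℝ (Em b)]
    [FiberBundle (EuclideanSpace ℝ (Fin km)) Em] [VectorBundle ℝ (EuclideanSpace ℝ (Fin km)) Em]
    [ContMDiffVectorBundle ∞ (EuclideanSpace ℝ (Fin km)) Em (𝓡 dm)]
    [IsContMDiffRiemannianBundle (𝓡 dm) ∞ (EuclideanSpace ℝ (Fin km)) Em]
    (D : DoubleDisk.LDDBD n dp kp dm km M Ep Em)
    (hp : 1 < n - dp) (hm : 1 < n - dm)
    (x : DoubleDisk.sphereBundle (EuclideanSpace ℝ (Fin kp)) Ep) :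
    (∃ (N : Subgroup (FundamentalGroup Lp (DoubleDisk.diskProj (EuclideanSpace ℝ (Fin kp)) Ep
          (DoubleDisk.boundaryIncl (EuclideanSpace ℝ (Fin kp)) Ep x)))) (_ : N.Normal),
        N = Subgroup.map
          (FundamentalGroup.map (DoubleDisk.diskProj (EuclideanSpace ℝ (Fin kp)) Ep) _)
          (D.imageOfKernel x) ∧
        Nonempty (N ≃* D.imageOfKernel x) ∧
        Nonempty (FundamentalGroup M (D.jp x) ≃*
          FundamentalGroup Lp (DoubleDisk.diskProj (EuclideanSpace ℝ (Fin kp)) Ep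
            (DoubleDisk.boundaryIncl (EuclideanSpace ℝ (Fin kp)) Ep x)) ⧸ N)) ∧
    (2 < n - dm →
      Nonempty (FundamentalGroup M (D.jp x) ≃*
        FundamentalGroup Lp (DoubleDisk.diskProj (EuclideanSpace ℝ (Fin kp)) Ep
          (DoubleDisk.boundaryIncl (EuclideanSpace ℝ (Fin kp)) Ep x)))) := by
  have hkp : 1 < kp := by have := D.dim_p; omega
  have hkm : 1 < km := by have := D.dim_m; omega
  have : IsContinuousRiemannianBundle (EuclideanSpace ℝ (Fin kp)) Ep :=
    IsContMDiffRiemannianBundle.isContinuousRiemannianBundle (𝓡 dp) ∞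
  obtain ⟨hsurj, hker⟩ := D.map_surjective_and_ker_eq hkp hkm x
  -- `P` transports the quotient of the group of the disk bundle to the quotient of the group of the
  -- base.
  let P := MulEquiv.ofBijective _ (DoubleDisk.map_diskProj_bijective (F := EuclideanSpace ℝ (Fin kp))
    (E := Ep) (by simpa using hkp) x)
  have hnormal : (D.imageOfKernel x).Normal := hker ▸ inferInstance
  let e := (QuotientGroup.quotientMulEquivOfEq hker.symm).trans
    (QuotientGroup.quotientKerEquivOfSurjective _ hsurj)
  let p := FundamentalGroup.map (DoubleDisk.diskProj (EuclideanSpace ℝ (Fin kp)) Ep)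
    (DoubleDisk.boundaryIncl (EuclideanSpace ℝ (Fin kp)) Ep x)
  have hN : ((D.imageOfKernel x).map p).Normal := hnormal.map p P.surjective
  refine ⟨⟨(D.imageOfKernel x).map p, hN, rfl,
    ⟨((D.imageOfKernel x).equivMapOfInjective p P.injective).symm⟩,
    ⟨e.symm.trans (QuotientGroup.congr (D.imageOfKernel x) ((D.imageOfKernel x).map p) P rfl)⟩⟩,
    fun hm' => ?_⟩
  -- With trivial kernel the surjection onto the group of `M` is itself an isomorphism.
  have hbot := D.imageOfKernel_eq_bot (by have := D.dim_m; omega) x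
  rw [hbot, MonoidHom.ker_eq_bot_iff] at hker
  exact ⟨(MulEquiv.ofBijective _ ⟨hker, hsurj⟩).symm.trans P⟩
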